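/- For a Lipschitz curve $\gamma=(\gamma^{(1)},\gamma^{(2)}):[0,1]\to\mathbb{R}^2$ and a function $F:\mathbb{R}^2\to[0,\infty)$ put $$E(\gamma)=\int_0^1F(\gamma)\,|\gamma'|\,dt,\qquad \mathcal{P}(\gamma)=-\int_0^1\gamma^{(2)}(\gamma^{(1)})'\,dt .$$ **Theorem 3.1.** Let $F:\mathbb{R}^2\to[0,\infty)$ be such that $W:=F^2$ is continuous and vanishes at precisely two distinct points $\mathbf{p}_+$ and $\mathbf{p}_-$. Suppose there are disjoint open balls $B_+$ and $B_-$ centered at $\mathbf{p}_+$ and $\mathbf{p}_-$ respectively, such that $W$ is smooth in each ball with positive definite Hessian at $\mathbf{p}_+$ and $\mathbf{p}_-$, and a number $m_0>0$ such that $F(p)\ge m_0$ for all $p\in\mathbb{R}^2\setminus(B_+\cup B_-)$. Assume moreover: *Assumption A.* For every point $\mathbf{p}_0$ in $B_+\setminus\{\mathbf{p}_+\}$ (resp. $B_-\setminus\{\mathbf{p}_-\}$) and every $A\in\mathbb{R}$, there exists a minimizer of $E$ among all Lipschitz curves $\gamma:[0,1]\to B_+$ (resp. $B_-$) with $\gamma(0)=\mathbf{p}_0$,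 $\gamma(1)=\mathbf{p}_+$ (resp. $\mathbf{p}_-$) and $\mathcal{P}(\gamma)=A$, and the Euclidean arclength $\int_0^1|\gamma'|\,dt$ of this minimizer is bounded by a constant depending on $W$, $\mathbf{p}_0$ and $A$. For $A_0\in\mathbb{R}$ let $$\mathcal{S}_{A_0}=\{\gamma:[0,1]\to\mathbb{R}^2:\ \gamma\text{ locally Lipschitz},\ \gamma(0)=\mathbf{p}_-,\ \gamma(1)=\mathbf{p}_+,\ \mathcal{P}(\gamma)=A_0\}.$$ Then for every $A_0\in\mathbb{R}$ there exists $\gamma_*\in\mathcal{S}_{A_0}$ with $E(\gamma_*)=\inf_{\gamma\in\mathcal{S}_{A_0}}E(\gamma)$. -/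

import Mathlib

open Set
open scoped ContDiff

noncomputable section

namespace Isoperimetric

/-- The Euclidean plane. The coordinates `p^{(1)}, p^{(2)}` of a point are `p 0, p 1`. -/
abbrev Plane : Type := EuclideanSpace ℝ (Fin 2)

/-! A curve `[0,1] → ℝ²` is represented by a function on `ℝ` of which only the values on `[0,1]`
matter. A locally Lipschitz curve is differentiable at almost every `t ∈ (0,1)`, so the integrals
below are the classical ones. -/

/-- The degenerate length `E(γ) = ∫₀¹ F(γ) |γ'| dt` for the conformal factor `F`. -/
def energy (F : Plane → ℝ) (γ : ℝ → Plane) : ℝ :=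
  ∫ t in (0 : ℝ)..1, F (γ t) * ‖deriv γ t‖

/-- The constraint functional `𝒫(γ) = -∫₀¹ γ^{(2)} (γ^{(1)})' dt`. -/
def area (γ : ℝ → Plane) : ℝ :=
  -∫ t in (0 : ℝ)..1, γ t 1 * deriv (fun s => γ s 0) t

/-- The Euclidean arclength `∫₀¹ |γ'| dt`. -/
def arclength (γ : ℝ → Plane) : ℝ :=
  ∫ t in (0 : ℝ)..1, ‖deriv γ t‖

/-- The admissible class of the two-well problem: locally Lipschitz curves `γ : [0,1] → ℝ²` from
`pm` to `pp` with `𝒫(γ) = A`. -/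
def twoWellClass (pm pp : Plane) (A : ℝ) : Set (ℝ → Plane) :=
  {γ | LocallyLipschitzOn (Icc 0 1) γ ∧ γ 0 = pm ∧ γ 1 = pp ∧ area γ = A}

/-- The admissible class of the one-well problem in a set `B`: Lipschitz curves `γ : [0,1] → B`
from `p₀` to the well `p` with `𝒫(γ) = A`. -/
def oneWellClass (B : Set Plane) (p₀ p : Plane) (A : ℝ) : Set (ℝ → Plane) :=
  {γ | (∃ K, LipschitzOnWith K γ (Icc 0 1)) ∧ MapsTo γ (Icc 0 1) B ∧
    γ 0 = p₀ ∧ γ 1 = p ∧ area γ = A}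

/-- `γ` is a minimizer of `E` within the class `S`. -/
def IsMinimizer (F : Plane → ℝ) (S : Set (ℝ → Plane)) (γ : ℝ → Plane) : Prop :=
  γ ∈ S ∧ ∀ σ ∈ S, energy F γ ≤ energy F σ

/-- Solvability of all one-well problems in `B` with well `p`: for every starting point
`p₀ ∈ B \ {p}` and every `A ∈ ℝ` there is a minimizer, whose Euclidean arclength is bounded by a
constant `L p₀ A` depending on `p₀` and `A` (and on `F`, `B`, `p`). -/
def OneWellSolvable (F : Plane → ℝ) (B : Set Plane) (p : Plane) : Prop :=
  ∃ L : Plane → ℝ → ℝ, ∀ p₀ ∈ B \ {p}, ∀ A : ℝ,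
    ∃ γ, IsMinimizer F (oneWellClass B p₀ p A) γ ∧ arclength γ ≤ L p₀ A

/-- The Hessian (second derivative) of `W` at `p` is positive definite. -/
def HessianPosDef (W : Plane → ℝ) (p : Plane) : Prop :=
  ∀ v : Plane, v ≠ 0 → 0 < fderiv ℝ (fderiv ℝ W) p v v

end Isoperimetric

end

open MeasureTheory Filter Topology

noncomputable section

namespace Isoperimetric

section

/-! ### Energy and area over subintervals -/

/-- The energy of the part of `γ` over `[a, b]`. -/
def energyOn (F : Plane → ℝ) (γ : ℝ → Plane) (a b : ℝ) : ℝ :=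
  ∫ t in a..b, F (γ t) * ‖deriv γ t‖

/-- The area functional of the part of `γ` over `[a, b]`. -/
def areaOn (γ : ℝ → Plane) (a b : ℝ) : ℝ :=
  -∫ t in a..b, γ t 1 * deriv (fun s => γ s 0) t

/-- There is a Lipschitz curve in `U` from `p` to `q` of area `A` and energy at most `e`. -/
def ReachIn (F : Plane → ℝ) (U : Set Plane) (p q : Plane) (A e : ℝ) : Prop :=
  ∃ γ : ℝ → Plane, (∃ K, LipschitzWith K γ) ∧ MapsTo γ (Icc 0 1) U ∧ γ 0 = p ∧ γ 1 = q ∧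
    area γ = A ∧ energy F γ ≤ e

variable {F : Plane → ℝ} {γ γ₁ γ₂ : ℝ → Plane} {K : NNReal} {U : Set Plane} {p q s : Plane}
  {a b c A A₁ A₂ e e₁ e₂ : ℝ}

theorem energyOn_zero_one : energyOn F γ 0 1 = energy F γ := rfl

theorem areaOn_zero_one : areaOn γ 0 1 = area γ := rfl

theorem lipschitzWith_coord (h : LipschitzWith K γ) (i : Fin 2) :
    LipschitzWith K (fun t => γ t i) := by
  refine LipschitzWith.of_dist_le_mul fun x y => ?_
  have h1 := h.dist_le_mul x y
  refine le_trans ?_ h1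
  rw [dist_eq_norm, dist_eq_norm]
  exact PiLp.norm_apply_le (γ x - γ y) i

theorem deriv_coord {t : ℝ} (h : DifferentiableAt ℝ γ t) (i : Fin 2) :
    deriv (fun s => γ s i) t = deriv γ t i :=
  ((EuclideanSpace.proj (𝕜 := ℝ) i).hasFDerivAt.comp_hasDerivAt t h.hasDerivAt).deriv

theorem intervalIntegrable_deriv {E : Type*} [NormedAddCommGroup E] [NormedSpace ℝ E]
    [FiniteDimensional ℝ E] {u : ℝ → E} (h : LipschitzWith K u) (a b : ℝ) :
    IntervalIntegrable (deriv u) volume a b := by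
  borelize E
  have : CompleteSpace E := FiniteDimensional.complete ℝ E
  have : SecondCountableTopology E := by
    have : ProperSpace E := FiniteDimensional.proper ℝ E
    infer_instance
  refine (intervalIntegrable_const (c := (K : ℝ))).mono_fun
    (measurable_deriv u).aestronglyMeasurable (Eventually.of_forall fun t => ?_)
  simpa using norm_deriv_le_of_lipschitz (x₀ := t) h

theorem intervalIntegrable_norm_deriv (h : LipschitzWith K γ) (a b : ℝ) :
    IntervalIntegrable (fun t => ‖deriv γ t‖) volume a b :=
  (intervalIntegrable_deriv h a b).norm

theorem intervalIntegrable_energy (hF : Continuous F) (h : LipschitzWith K γ) (a b : ℝ) :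
    IntervalIntegrable (fun t => F (γ t) * ‖deriv γ t‖) volume a b :=
  (intervalIntegrable_norm_deriv h a b).continuousOn_mul (hF.comp h.continuous).continuousOn

theorem intervalIntegrable_area (h : LipschitzWith K γ) (a b : ℝ) :
    IntervalIntegrable (fun t => γ t 1 * deriv (fun s => γ s 0) t) volume a b :=
  (intervalIntegrable_deriv (lipschitzWith_coord h 0) a b).continuousOn_mul
    (lipschitzWith_coord h 1).continuous.continuousOn

theorem energyOn_add (hF : Continuous F) (h : LipschitzWith K γ) (a b c : ℝ) :
    energyOn F γ a b + energyOn F γ b c = energyOn F γ a c :=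
  intervalIntegral.integral_add_adjacent_intervals (intervalIntegrable_energy hF h a b)
    (intervalIntegrable_energy hF h b c)

theorem areaOn_add (h : LipschitzWith K γ) (a b c : ℝ) :
    areaOn γ a b + areaOn γ b c = areaOn γ a c := by
  have := intervalIntegral.integral_add_adjacent_intervals (intervalIntegrable_area h a b)
    (intervalIntegrable_area h b c)
  simp only [areaOn, ← this]
  ring

theorem energyOn_nonneg (hF : ∀ p, 0 ≤ F p) (hab : a ≤ b) : 0 ≤ energyOn F γ a b :=
  intervalIntegral.integral_nonneg hab fun _ _ => mul_nonneg (hF _) (norm_nonneg _)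

theorem energyOn_congr (hab : a ≤ b) (h : EqOn γ₁ γ₂ (Ioo a b)) :
    energyOn F γ₁ a b = energyOn F γ₂ a b := by
  refine intervalIntegral.integral_congr_Ioo_of_le hab fun t ht => ?_
  have : γ₁ =ᶠ[𝓝 t] γ₂ := h.eventuallyEq_of_mem (Ioo_mem_nhds ht.1 ht.2)
  simp only [this.deriv_eq, h ht]

theorem areaOn_congr (hab : a ≤ b) (h : EqOn γ₁ γ₂ (Ioo a b)) :
    areaOn γ₁ a b = areaOn γ₂ a b := by
  refine congrArg _ (intervalIntegral.integral_congr_Ioo_of_le hab fun t ht => ?_)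
  have : (fun s => γ₁ s 0) =ᶠ[𝓝 t] (fun s => γ₂ s 0) :=
    (h.eventuallyEq_of_mem (Ioo_mem_nhds ht.1 ht.2)).mono fun s hs => by simp only [hs]
  simp only [this.deriv_eq, h ht]

theorem deriv_comp_affine {E : Type*} [NormedAddCommGroup E] [NormedSpace ℝ E] (u : ℝ → E)
    (c d t : ℝ) : deriv (fun x => u (c * x + d)) t = c • deriv u (c * t + d) := by
  have h1 := deriv_comp_mul_left c (fun y => u (y + d)) t
  rw [h1, deriv_comp_add_const]

theorem areaOn_comp_affine (γ : ℝ → Plane) (c d a b : ℝ) :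
    areaOn (fun x => γ (c * x + d)) a b = areaOn γ (c * a + d) (c * b + d) := by
  have h := intervalIntegral.smul_integral_comp_mul_add (a := a) (b := b)
    (fun t => γ t 1 * deriv (fun s => γ s 0) t) c d
  rw [areaOn, areaOn, ← h, smul_eq_mul, ← intervalIntegral.integral_const_mul]
  congr 2
  ext t
  rw [deriv_comp_affine (fun s => γ s 0), smul_eq_mul]
  ring

theorem energyOn_comp_affine (F : Plane → ℝ) (γ : ℝ → Plane) (c d a b : ℝ) (hc : 0 ≤ c) :
    energyOn F (fun x => γ (c * x + d)) a b = energyOn F γ (c * a + d) (c * b + d) := by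
  have h := intervalIntegral.smul_integral_comp_mul_add (a := a) (b := b)
    (fun t => F (γ t) * ‖deriv γ t‖) c d
  rw [energyOn, energyOn, ← h, smul_eq_mul, ← intervalIntegral.integral_const_mul]
  congr 1
  ext t
  rw [deriv_comp_affine γ, norm_smul, Real.norm_of_nonneg hc]
  ring

theorem energyOn_comp_neg_affine (F : Plane → ℝ) (γ : ℝ → Plane) (d a b : ℝ) :
    energyOn F (fun x => γ (-1 * x + d)) a b = energyOn F γ (-1 * b + d) (-1 * a + d) := by
  have h := intervalIntegral.smul_integral_comp_mul_add (a := a) (b := b)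
    (fun t => F (γ t) * ‖deriv γ t‖) (-1) d
  rw [energyOn, energyOn, intervalIntegral.integral_symm (-1 * a + d), ← h, smul_eq_mul, neg_mul,
    one_mul, neg_neg]
  congr 1
  ext t
  rw [deriv_comp_affine γ, norm_smul]
  simp

theorem lipschitzWith_affine (c d : ℝ) : LipschitzWith ‖c‖₊ (fun x : ℝ => c * x + d) :=
  LipschitzWith.of_dist_le_mul fun x y => by
    rw [Real.dist_eq, Real.dist_eq, coe_nnnorm, Real.norm_eq_abs, ← abs_mul]
    exact le_of_eq (by congr 1; ring)

theorem reachIn_of_interval (h : LipschitzWith K γ) (hab : a ≤ b) (hU : MapsTo γ (Icc a b) U) :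
    ReachIn F U (γ a) (γ b) (areaOn γ a b) (energyOn F γ a b) := by
  refine ⟨fun x => γ ((b - a) * x + a), ⟨_, h.comp (lipschitzWith_affine (b - a) a)⟩,
    fun t ht => hU ⟨?_, ?_⟩, by simp, by simp, ?_, ?_⟩
  · nlinarith [ht.1, ht.2]
  · nlinarith [ht.1, ht.2]
  · rw [← areaOn_zero_one, areaOn_comp_affine]
    simp
  · rw [← energyOn_zero_one, energyOn_comp_affine _ _ _ _ _ _ (by linarith)]
    simp

theorem ReachIn.mono {V : Set Plane} (h : ReachIn F U p q A e₁) (hUV : U ⊆ V) (he : e₁ ≤ e₂) :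
    ReachIn F V p q A e₂ := by
  obtain ⟨γ, hK, hU, h0, h1, hA, hE⟩ := h
  exact ⟨γ, hK, hU.mono_right hUV, h0, h1, hA, hE.trans he⟩

theorem ReachIn.symm (h : ReachIn F U p q A e) : ReachIn F U q p (-A) e := by
  obtain ⟨γ, ⟨K, hK⟩, hU, h0, h1, hA, hE⟩ := h
  refine ⟨fun x => γ (-1 * x + 1), ⟨_, hK.comp (lipschitzWith_affine (-1) 1)⟩,
    fun t ht => hU ⟨by linarith [ht.2], by linarith [ht.1]⟩, by simpa using h1, by simpa using h0,
    ?_, ?_⟩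
  · rw [← areaOn_zero_one, areaOn_comp_affine, ← hA, area, areaOn, neg_neg]
    norm_num
    rw [intervalIntegral.integral_symm, neg_neg]
  · rw [← energyOn_zero_one, energyOn_comp_neg_affine]
    simpa [energyOn_zero_one] using hE

theorem ReachIn.trans (hF : Continuous F) (h₁ : ReachIn F U p q A₁ e₁)
    (h₂ : ReachIn F U q s A₂ e₂) : ReachIn F U p s (A₁ + A₂) (e₁ + e₂) := by
  obtain ⟨γ₁, ⟨K₁, hK₁⟩, hU₁, h0₁, h1₁, hA₁, hE₁⟩ := h₁
  obtain ⟨γ₂, ⟨K₂, hK₂⟩, hU₂, h0₂, h1₂, hA₂, hE₂⟩ := h₂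
  set γ : ℝ → Plane := fun t => γ₁ (min t 1) + γ₂ (max (1 * t + -1) 0) - q with hγ
  have hl : LipschitzWith (K₁ * 1 + K₂ * (‖(1 : ℝ)‖₊)) γ := by
    have e1 : LipschitzWith (K₁ * 1) (fun t : ℝ => γ₁ (min t 1)) :=
      hK₁.comp (LipschitzWith.id.min_const 1)
    have e2 : LipschitzWith (K₂ * ‖(1 : ℝ)‖₊) (fun t : ℝ => γ₂ (max (1 * t + -1) 0)) :=
      hK₂.comp ((lipschitzWith_affine 1 (-1)).max_const 0)
    have := (e1.add e2).sub (LipschitzWith.const q)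
    simpa only [add_zero] using this
  have l1 : ∀ t ≤ 1, γ t = γ₁ t := fun t ht => by
    simp [hγ, min_eq_left ht, max_eq_right (show t + -1 ≤ 0 by linarith), h0₂]
  have l2 : ∀ t, 1 ≤ t → γ t = γ₂ (1 * t + -1) := fun t ht => by
    simp only [hγ, min_eq_right ht, max_eq_left (show 0 ≤ 1 * t + -1 by linarith), h1₁]
    abel
  have key := reachIn_of_interval (F := F) (U := U) hl (show (0 : ℝ) ≤ 2 by norm_num) ?_
  · have ea : areaOn γ 0 2 = A₁ + A₂ := by
      rw [← areaOn_add hl 0 1 2, areaOn_congr zero_le_one (fun t ht => l1 t ht.2.le),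
        areaOn_congr one_le_two (fun t ht => l2 t ht.1.le), areaOn_comp_affine, ← hA₁, ← hA₂,
        ← areaOn_zero_one, ← areaOn_zero_one]
      norm_num
    have ee : energyOn F γ 0 2 = energy F γ₁ + energy F γ₂ := by
      rw [← energyOn_add hF hl 0 1 2, energyOn_congr zero_le_one (fun t ht => l1 t ht.2.le),
        energyOn_congr one_le_two (fun t ht => l2 t ht.1.le),
        energyOn_comp_affine _ _ _ _ _ _ zero_le_one, ← energyOn_zero_one, ← energyOn_zero_one]
      norm_num
    rw [ea, ee, l1 0 zero_le_one, l2 2 one_le_two, h0₁] at key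
    norm_num [h1₂] at key
    exact key.mono subset_rfl (add_le_add hE₁ hE₂)
  · intro t ht
    rcases le_total t 1 with h | h
    · rw [l1 t h]
      exact hU₁ ⟨ht.1, h⟩
    · rw [l2 t h]
      exact hU₂ ⟨by linarith, by linarith [ht.2]⟩

theorem ReachIn.nonneg (hF : ∀ p, 0 ≤ F p) (h : ReachIn F U p q A e) : 0 ≤ e := by
  obtain ⟨γ, -, -, -, -, -, hE⟩ := h
  exact le_trans (energyOn_nonneg (γ := γ) hF zero_le_one) hE

/-- A curve that is Lipschitz only on `[0, 1]` may be extended to all of `ℝ`. -/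
theorem reachIn_of_lipschitzOnWith (h : LipschitzOnWith K γ (Icc 0 1))
    (hU : MapsTo γ (Icc 0 1) U) : ReachIn F U (γ 0) (γ 1) (area γ) (energy F γ) := by
  obtain ⟨g, hg, hgγ⟩ := h.extend_finite_dimension
  refine ⟨g, ⟨_, hg⟩, fun t ht => hgγ ht ▸ hU ht, (hgγ ⟨le_rfl, zero_le_one⟩).symm,
    (hgγ ⟨zero_le_one, le_rfl⟩).symm, ?_, ?_⟩
  · exact areaOn_congr zero_le_one fun t ht => (hgγ (Ioo_subset_Icc_self ht)).symm
  · exact (energyOn_congr zero_le_one fun t ht => (hgγ (Ioo_subset_Icc_self ht)).symm).le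

end

section

/-! ### Short connections with prescribed area -/

variable {F : Plane → ℝ} {U : Set Plane} {p q : Plane} {A e ε M : ℝ}

/-- The segment from `p` to `q`, perturbed by a cubic loop with horizontal size `a` and vertical
size `b`. -/
def connection (p q : Plane) (a b : ℝ) (t : ℝ) : Plane :=
  p + t • (q - p) + (t * (1 - t)) • EuclideanSpace.single 0 a +
    (t * (1 - t) * (1 - 2 * t)) • EuclideanSpace.single 1 b

theorem hasDerivAt_connection (p q : Plane) (a b t : ℝ) :
    HasDerivAt (connection p q a b) ((q - p) + (1 - 2 * t) • EuclideanSpace.single 0 a +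
      (1 - 6 * t + 6 * t ^ 2) • EuclideanSpace.single 1 b) t := by
  have h1 : HasDerivAt (fun t : ℝ => t • (q - p)) ((1 : ℝ) • (q - p)) t :=
    (hasDerivAt_id t).smul_const _
  have h2 : HasDerivAt (fun t : ℝ => t * (1 - t)) (1 - 2 * t) t :=
    ((hasDerivAt_id t).mul ((hasDerivAt_id t).const_sub 1)).congr_deriv (by simp; ring)
  have h3 : HasDerivAt (fun t : ℝ => t * (1 - t) * (1 - 2 * t)) (1 - 6 * t + 6 * t ^ 2) t :=
    (h2.mul (((hasDerivAt_id t).const_mul 2).const_sub 1)).congr_deriv (by simp; ring)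
  have h := ((h1.const_add p).add (h2.smul_const (EuclideanSpace.single (0 : Fin 2) a))).add
    (h3.smul_const (EuclideanSpace.single (1 : Fin 2) b))
  rw [one_smul] at h
  exact h

theorem norm_deriv_connection_le {t : ℝ} (ht : t ∈ Icc (0 : ℝ) 1) (p q : Plane) (a b : ℝ) :
    ‖deriv (connection p q a b) t‖ ≤ ‖q - p‖ + |a| + |b| := by
  rw [(hasDerivAt_connection p q a b t).deriv]
  refine (norm_add₃_le).trans ?_
  rw [norm_smul, norm_smul, PiLp.norm_single, PiLp.norm_single]
  have h1 : ‖1 - 2 * t‖ ≤ 1 := by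
    rw [Real.norm_eq_abs, abs_le]; constructor <;> linarith [ht.1, ht.2]
  have h2 : ‖1 - 6 * t + 6 * t ^ 2‖ ≤ 1 := by
    rw [Real.norm_eq_abs, abs_le]; constructor <;> nlinarith [ht.1, ht.2, sq_nonneg (2 * t - 1)]
  have := mul_le_mul_of_nonneg_right h1 (norm_nonneg a)
  have := mul_le_mul_of_nonneg_right h2 (norm_nonneg b)
  simp only [Real.norm_eq_abs] at *
  linarith

theorem norm_connection_sub_le {t : ℝ} (ht : t ∈ Icc (0 : ℝ) 1) (p q : Plane) (a b : ℝ) :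
    ‖connection p q a b t - p‖ ≤ ‖q - p‖ + |a| + |b| := by
  have : connection p q a b t - p = t • (q - p) + (t * (1 - t)) • EuclideanSpace.single 0 a +
    (t * (1 - t) * (1 - 2 * t)) • EuclideanSpace.single 1 b := by
    rw [connection]; abel
  rw [this]
  refine (norm_add₃_le).trans ?_
  rw [norm_smul, norm_smul, norm_smul, PiLp.norm_single, PiLp.norm_single]
  have h0 : ‖t‖ ≤ 1 := by
    rw [Real.norm_eq_abs, abs_le]; constructor <;> linarith [ht.1, ht.2]
  have h1 : ‖1 - t‖ ≤ 1 := by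
    rw [Real.norm_eq_abs, abs_le]; constructor <;> linarith [ht.1, ht.2]
  have h2 : ‖1 - 2 * t‖ ≤ 1 := by
    rw [Real.norm_eq_abs, abs_le]; constructor <;> linarith [ht.1, ht.2]
  have h3 : ‖t * (1 - t)‖ ≤ 1 := by
    rw [norm_mul]; exact mul_le_one₀ h0 (norm_nonneg _) h1
  have h4 : ‖t * (1 - t) * (1 - 2 * t)‖ ≤ 1 := by
    rw [norm_mul]; exact mul_le_one₀ h3 (norm_nonneg _) h2
  have := mul_le_mul_of_nonneg_right h0 (norm_nonneg (q - p))
  have := mul_le_mul_of_nonneg_right h3 (norm_nonneg a)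
  have := mul_le_mul_of_nonneg_right h4 (norm_nonneg b)
  simp only [Real.norm_eq_abs] at *
  linarith

theorem area_connection (p q : Plane) (a b : ℝ) :
    area (connection p q a b) =
      -((p 1 + q 1) / 2 * (q 0 - p 0)) + a * (q 1 - p 1) / 6 - a * b / 30 := by
  have hd : ∀ t, deriv (fun s => connection p q a b s 0) t = (q 0 - p 0) + (1 - 2 * t) * a := by
    intro t
    have h := hasDerivAt_connection p q a b t
    rw [deriv_coord h.differentiableAt, h.deriv]
    simp
  have h1 : ∀ t, connection p q a b t 1 =
      p 1 + t * (q 1 - p 1) + t * (1 - t) * (1 - 2 * t) * b := by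
    intro t; simp [connection]
  simp only [area, hd, h1]
  have key : ∀ t ∈ uIcc (0 : ℝ) 1, HasDerivAt (fun t : ℝ =>
      (q 0 - p 0) * (p 1 * t + (q 1 - p 1) * t ^ 2 / 2 + b * (t ^ 2 / 2 - t ^ 3 + t ^ 4 / 2)) +
      a * (p 1 * (t - t ^ 2) + (q 1 - p 1) * (t ^ 2 / 2 - 2 * t ^ 3 / 3) +
        b * (t ^ 2 / 2 - 5 * t ^ 3 / 3 + 2 * t ^ 4 - 4 * t ^ 5 / 5)))
      ((p 1 + t * (q 1 - p 1) + t * (1 - t) * (1 - 2 * t) * b) *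
        ((q 0 - p 0) + (1 - 2 * t) * a)) t := by
    intro t _
    have i : ∀ n : ℕ, HasDerivAt (fun t : ℝ => t ^ n) (n * t ^ (n - 1)) t := fun n =>
      hasDerivAt_pow n t
    have i1 := hasDerivAt_id' t
    have i2 := i 2
    have i3 := i 3
    have i4 := i 4
    have i5 := i 5
    refine ((((i1.const_mul (p 1)).add ((i2.const_mul (q 1 - p 1)).div_const 2)).add
      ((((i2.div_const 2).sub i3).add (i4.div_const 2)).const_mul b)).const_mul (q 0 - p 0)
      |>.add ((((i1.sub i2).const_mul (p 1)).add
        ((((i2.div_const 2).sub ((i3.const_mul 2).div_const 3))).const_mul (q 1 - p 1))).add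
        (((((i2.div_const 2).sub ((i3.const_mul 5).div_const 3)).add (i4.const_mul 2)).sub
          ((i5.const_mul 4).div_const 5)).const_mul b) |>.const_mul a)).congr_deriv ?_
    norm_num
    ring
  rw [intervalIntegral.integral_eq_sub_of_hasDerivAt key
    (Continuous.intervalIntegrable (by fun_prop) _ _)]
  ring

theorem lipschitzOnWith_connection (p q : Plane) (a b : ℝ) :
    LipschitzOnWith (Real.toNNReal (‖q - p‖ + |a| + |b|)) (connection p q a b) (Icc 0 1) := by
  refine Convex.lipschitzOnWith_of_nnnorm_deriv_le
    (fun t _ => (hasDerivAt_connection p q a b t).differentiableAt) (fun t ht => ?_)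
    (convex_Icc 0 1)
  rw [← NNReal.coe_le_coe, coe_nnnorm, Real.coe_toNNReal _ (by positivity)]
  exact norm_deriv_connection_le ht p q a b

theorem reachIn_connection (hF : Continuous F) {a b r : ℝ} (hr : ‖q - p‖ + |a| + |b| ≤ r)
    (hU : Metric.closedBall p r ⊆ U) (hM : ∀ x ∈ Metric.closedBall p r, F x ≤ M)
    (hF0 : ∀ x, 0 ≤ F x) :
    ReachIn F U p q (area (connection p q a b)) (M * r) := by
  have hmem : ∀ t ∈ Icc (0 : ℝ) 1, connection p q a b t ∈ Metric.closedBall p r := fun t ht => by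
    rw [mem_closedBall_iff_norm]; exact (norm_connection_sub_le ht p q a b).trans hr
  have h := reachIn_of_lipschitzOnWith (F := F) (lipschitzOnWith_connection p q a b)
    (U := U) (fun t ht => hU (hmem t ht))
  have h0 : connection p q a b 0 = p := by simp [connection]
  have h1 : connection p q a b 1 = q := by simp [connection]
  rw [h0, h1] at h
  refine h.mono subset_rfl ?_
  have hMr : ∀ t ∈ Icc (0 : ℝ) 1,
      F (connection p q a b t) * ‖deriv (connection p q a b) t‖ ≤ M * r := fun t ht =>
    mul_le_mul (hM _ (hmem t ht)) ((norm_deriv_connection_le ht p q a b).trans hr)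
      (norm_nonneg _) ((hF0 _).trans (hM _ (hmem t ht)))
  have hc : Continuous (connection p q a b) := by unfold connection; fun_prop
  have hd : deriv (connection p q a b) = fun t => (q - p) + (1 - 2 * t) •
      EuclideanSpace.single 0 a + (1 - 6 * t + 6 * t ^ 2) • EuclideanSpace.single 1 b := by
    ext1 t; exact (hasDerivAt_connection p q a b t).deriv
  have hcd : Continuous (deriv (connection p q a b)) := by rw [hd]; fun_prop
  have := intervalIntegral.integral_mono_on (μ := volume) zero_le_one
    (((hF.comp hc).mul hcd.norm).intervalIntegrable 0 1)
    (intervalIntegrable_const (c := M * r)) hMr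
  simpa [energy] using this

/-- The area defect of a segment. -/
def segmentDefect (p : Plane) (y : Plane × ℝ) : ℝ :=
  30 * (-((p 1 + y.1 1) / 2 * (y.1 0 - p 0)) - y.2)

/-- The horizontal size of the loop correcting the area of a segment. -/
def loopSize (p : Plane) (y : Plane × ℝ) : ℝ := √|segmentDefect p y|

theorem area_connection_loopSize (p : Plane) (y : Plane × ℝ) :
    area (connection p y.1 (loopSize p y)
      (SignType.sign (segmentDefect p y) * loopSize p y + 5 * (y.1 1 - p 1))) = y.2 := by
  rw [area_connection]
  have h1 : loopSize p y * (SignType.sign (segmentDefect p y) * loopSize p y) =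
      segmentDefect p y := by
    rw [mul_left_comm, loopSize, Real.mul_self_sqrt (abs_nonneg _), sign_mul_abs]
  have h2 : segmentDefect p y = 30 * (-((p 1 + y.1 1) / 2 * (y.1 0 - p 0)) - y.2) := rfl
  linear_combination (-1 / 30) * h1 + (-1 / 30) * h2

/-- Bound for the size of the connection with prescribed end point and area. -/
def connectionSize (p : Plane) (y : Plane × ℝ) : ℝ :=
  ‖y.1 - p‖ + 2 * loopSize p y + 5 * |y.1 1 - p 1|

theorem connectionSize_bound (p : Plane) (y : Plane × ℝ) :
    ‖y.1 - p‖ + |loopSize p y| +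
      |SignType.sign (segmentDefect p y) * loopSize p y + 5 * (y.1 1 - p 1)| ≤
      connectionSize p y := by
  have h0 : 0 ≤ loopSize p y := Real.sqrt_nonneg _
  have h1 : |(SignType.sign (segmentDefect p y) : ℝ) * loopSize p y| ≤ loopSize p y := by
    rw [abs_mul, abs_of_nonneg h0]
    refine mul_le_of_le_one_left h0 ?_
    rcases SignType.trichotomy (SignType.sign (segmentDefect p y)) with h | h | h <;> simp [h]
  have h2 := abs_add_le ((SignType.sign (segmentDefect p y) : ℝ) * loopSize p y)
    (5 * (y.1 1 - p 1))
  rw [abs_mul 5, abs_of_nonneg (by norm_num : (0 : ℝ) ≤ 5)] at h2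
  rw [connectionSize, abs_of_nonneg h0]
  linarith

theorem tendsto_connectionSize (p : Plane) :
    Tendsto (connectionSize p) (𝓝 (p, 0)) (𝓝 0) := by
  have hc : Continuous (connectionSize p) := by
    unfold connectionSize loopSize segmentDefect; fun_prop
  have := hc.tendsto (p, 0)
  simpa [connectionSize, loopSize, segmentDefect] using this

theorem reachIn_connectionSize (hF : Continuous F) (hF0 : ∀ x, 0 ≤ F x) {p : Plane}
    {y : Plane × ℝ} {r : ℝ} (hr : connectionSize p y ≤ r) (hU : Metric.closedBall p r ⊆ U)
    (hM : ∀ x ∈ Metric.closedBall p r, F x ≤ M) : ReachIn F U p y.1 y.2 (M * r) := by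
  have h := reachIn_connection hF ((connectionSize_bound p y).trans hr) hU hM hF0
  rwa [area_connection_loopSize] at h

/-- Nearby points may be connected cheaply by curves with any prescribed small area. -/
theorem eventually_reachIn (hF : Continuous F) (hF0 : ∀ x, 0 ≤ F x) (hU : U ∈ 𝓝 p) (hε : 0 < ε) :
    ∀ᶠ y : Plane × ℝ in 𝓝 (p, 0), ReachIn F U p y.1 y.2 ε := by
  obtain ⟨r₀, hr₀, hsub⟩ := Metric.nhds_basis_closedBall.mem_iff.1
    (inter_mem hU (hF.continuousAt.eventually (gt_mem_nhds (lt_add_one (F p)))))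
  set r := min r₀ (ε / (F p + 1)) with hr
  have hFp : 0 < F p + 1 := by linarith [hF0 p]
  have hr0 : 0 < r := lt_min hr₀ (div_pos hε hFp)
  have hb : Metric.closedBall p r ⊆ Metric.closedBall p r₀ :=
    Metric.closedBall_subset_closedBall (min_le_left _ _)
  filter_upwards [(tendsto_connectionSize p).eventually (gt_mem_nhds hr0)] with y hy
  refine (reachIn_connectionSize hF hF0 hy.le (fun x hx => (hsub (hb hx)).1)
    (fun x hx => (hsub (hb hx)).2.le)).mono subset_rfl ?_
  calc (F p + 1) * r ≤ (F p + 1) * (ε / (F p + 1)) := by gcongr; exact min_le_right _ _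
    _ = ε := by field_simp

theorem exists_reachIn_univ (hF : Continuous F) (hF0 : ∀ x, 0 ≤ F x) (p q : Plane) (A : ℝ) :
    ∃ e, ReachIn F univ p q A e := by
  obtain ⟨M, hM⟩ := ((isCompact_closedBall p (connectionSize p (q, A))).image hF).bddAbove
  exact ⟨_, reachIn_connectionSize (y := (q, A)) hF hF0 le_rfl (subset_univ _)
    fun x hx => hM (mem_image_of_mem F hx)⟩

end

section

/-! ### Uniform limits of equi-Lipschitz curves -/

variable {ι : Type*} {l : Filter ι}

theorem intervalIntegrable_mul_of_abs_le {f g : ℝ → ℝ} {C : ℝ}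
    (hf : IntervalIntegrable f volume 0 1) (hg : Measurable g) (hC : ∀ t, |g t| ≤ C) :
    IntervalIntegrable (fun t => f t * g t) volume 0 1 :=
  ⟨hf.1.mul_bdd hg.aestronglyMeasurable (Eventually.of_forall hC),
    hf.2.mul_bdd hg.aestronglyMeasurable (Eventually.of_forall hC)⟩

theorem abs_integral_mul_le {f g : ℝ → ℝ} {C : ℝ} (hg : ∀ t, |g t| ≤ C)
    (hf : IntervalIntegrable f volume 0 1) :
    |∫ t in (0 : ℝ)..1, f t * g t| ≤ (∫ t in (0 : ℝ)..1, |f t|) * C := by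
  rw [← intervalIntegral.integral_mul_const, ← Real.norm_eq_abs]
  refine intervalIntegral.norm_integral_le_of_norm_le zero_le_one
    (Eventually.of_forall fun t _ => ?_) (hf.abs.mul_const C)
  rw [norm_mul]
  exact mul_le_mul_of_nonneg_left (hg t) (abs_nonneg _)

theorem abs_integral_mul_le_of_abs_le {f g : ℝ → ℝ} {C D : ℝ} (hg : ∀ t, |g t| ≤ C)
    (hf : ∀ t ∈ Icc (0 : ℝ) 1, |f t| ≤ D) :
    |∫ t in (0 : ℝ)..1, f t * g t| ≤ D * C := by
  have := intervalIntegral.norm_integral_le_of_norm_le_const (a := 0) (b := 1)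
    (f := fun t => f t * g t) (C := D * C) fun t ht => by
      rw [uIoc_of_le zero_le_one] at ht
      have h := hf t (Ioc_subset_Icc_self ht)
      rw [norm_mul]
      exact mul_le_mul h (hg t) (norm_nonneg _) ((abs_nonneg _).trans h)
  simpa using this

theorem absolutelyContinuousOnInterval_of_lipschitzWith {u : ℝ → ℝ} {K : NNReal}
    (h : LipschitzWith K u) (a b : ℝ) : AbsolutelyContinuousOnInterval u a b :=
  h.lipschitzOnWith.absolutelyContinuousOnInterval

theorem absolutelyContinuousOnInterval_polynomial (P : Polynomial ℝ) (a b : ℝ) :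
    AbsolutelyContinuousOnInterval (fun t => P.eval t) a b :=
  (P.contDiff_aeval 1).contDiffOn.absolutelyContinuousOnInterval

theorem tendsto_integral_mul_of_tendstoUniformlyOn {g : ℝ → ℝ} {u : ι → ℝ → ℝ} {v : ℝ → ℝ}
    (hg : Continuous g) (hu : ∀ i, Continuous (u i)) (hv : Continuous v)
    (h : TendstoUniformlyOn u v l (Icc 0 1)) :
    Tendsto (fun i => ∫ t in (0 : ℝ)..1, g t * u i t) l (𝓝 (∫ t in (0 : ℝ)..1, g t * v t)) := by
  obtain ⟨C, hC⟩ := (isCompact_Icc (a := (0 : ℝ)) (b := 1)).exists_bound_of_continuousOn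
    hg.continuousOn
  have hC0 : 0 ≤ C := (norm_nonneg _).trans (hC 0 ⟨le_rfl, zero_le_one⟩)
  rw [Metric.tendsto_nhds]
  intro ε hε
  filter_upwards [Metric.tendstoUniformlyOn_iff.1 h (ε / (C + 1)) (by positivity)] with i hi
  have hi1 : Continuous fun t => g t * u i t := hg.mul (hu i)
  have hi2 : Continuous fun t => g t * v t := hg.mul hv
  rw [Real.dist_eq, ← intervalIntegral.integral_sub (hi1.intervalIntegrable _ _)
    (hi2.intervalIntegrable _ _)]
  have := intervalIntegral.norm_integral_le_of_norm_le_const (a := 0) (b := 1)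
    (f := fun t => g t * u i t - g t * v t) (C := C * (ε / (C + 1))) fun t ht => by
      rw [uIoc_of_le zero_le_one] at ht
      have h := hi t (Ioc_subset_Icc_self ht)
      rw [dist_comm, Real.dist_eq] at h
      rw [← mul_sub, norm_mul]
      exact mul_le_mul (hC t (Ioc_subset_Icc_self ht)) h.le (norm_nonneg _) hC0
  refine lt_of_le_of_lt (by simpa using this) ?_
  rw [← mul_div_assoc, div_lt_iff₀ (by positivity)]
  nlinarith

theorem exists_polynomial_integral_abs_sub_le {g : ℝ → ℝ} (hg : IntervalIntegrable g volume 0 1)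
    {ε : ℝ} (hε : 0 < ε) :
    ∃ P : Polynomial ℝ, ∫ t in (0 : ℝ)..1, |g t - P.eval t| ≤ ε := by
  have hgi : Integrable ((Ioc (0 : ℝ) 1).indicator g) :=
    (integrable_indicator_iff measurableSet_Ioc).2
      ((intervalIntegrable_iff_integrableOn_Ioc_of_le zero_le_one).1 hg)
  obtain ⟨h, -, hgh, hc, hi⟩ := hgi.exists_hasCompactSupport_integral_sub_le (half_pos hε)
  obtain ⟨P, hP⟩ := exists_polynomial_near_of_continuousOn 0 1 h hc.continuousOn _ (half_pos hε)
  refine ⟨P, ?_⟩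
  have hPc : Continuous fun t => P.eval t := P.continuous
  have h1 : ∫ t in (0 : ℝ)..1, |g t - h t| ≤ ε / 2 := by
    refine le_trans ?_ hgh
    rw [intervalIntegral.integral_of_le zero_le_one]
    calc ∫ t in Ioc (0 : ℝ) 1, |g t - h t|
        = ∫ t in Ioc (0 : ℝ) 1, ‖(Ioc (0 : ℝ) 1).indicator g t - h t‖ :=
          setIntegral_congr_fun measurableSet_Ioc fun t ht => by
            simp [indicator_of_mem ht]
      _ ≤ _ := setIntegral_le_integral (hgi.sub hi).norm
          (Eventually.of_forall fun _ => norm_nonneg _)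
  have h2 : ∫ t in (0 : ℝ)..1, |h t - P.eval t| ≤ ε / 2 := by
    have := intervalIntegral.integral_mono_on (μ := volume) zero_le_one
      ((hc.sub hPc).abs.intervalIntegrable 0 1) (intervalIntegrable_const (c := ε / 2))
      fun t ht => by
        have := (hP t ht).le
        rwa [abs_sub_comm] at this
    simpa using this
  have hgP : IntervalIntegrable (fun t => |g t - P.eval t|) volume 0 1 :=
    (hg.sub (hPc.intervalIntegrable 0 1)).abs
  have hgh' : IntervalIntegrable (fun t => |g t - h t|) volume 0 1 :=
    (hg.sub (hc.intervalIntegrable 0 1)).abs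
  have hhP : IntervalIntegrable (fun t => |h t - P.eval t|) volume 0 1 :=
    (hc.sub hPc).abs.intervalIntegrable 0 1
  calc ∫ t in (0 : ℝ)..1, |g t - P.eval t|
      ≤ ∫ t in (0 : ℝ)..1, (|g t - h t| + |h t - P.eval t|) :=
        intervalIntegral.integral_mono_on zero_le_one hgP (hgh'.add hhP)
          fun t _ => abs_sub_le _ _ _
    _ = (∫ t in (0 : ℝ)..1, |g t - h t|) + ∫ t in (0 : ℝ)..1, |h t - P.eval t| :=
        intervalIntegral.integral_add hgh' hhP
    _ ≤ ε := by linarith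

/-- Derivatives of uniformly converging equi-Lipschitz functions converge weakly in `L¹`. -/
theorem tendsto_integral_mul_deriv {g : ℝ → ℝ} {u : ι → ℝ → ℝ} {v : ℝ → ℝ} {K : NNReal}
    (hg : IntervalIntegrable g volume 0 1) (hu : ∀ i, LipschitzWith K (u i))
    (hv : LipschitzWith K v) (h : TendstoUniformlyOn u v l (Icc 0 1)) :
    Tendsto (fun i => ∫ t in (0 : ℝ)..1, g t * deriv (u i) t) l
      (𝓝 (∫ t in (0 : ℝ)..1, g t * deriv v t)) := by
  have poly : ∀ P : Polynomial ℝ, Tendsto (fun i => ∫ t in (0 : ℝ)..1, P.eval t * deriv (u i) t) l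
      (𝓝 (∫ t in (0 : ℝ)..1, P.eval t * deriv v t)) := by
    intro P
    have ibp : ∀ w : ℝ → ℝ, LipschitzWith K w → ∫ t in (0 : ℝ)..1, P.eval t * deriv w t =
        P.eval 1 * w 1 - P.eval 0 * w 0 - ∫ t in (0 : ℝ)..1, P.derivative.eval t * w t := by
      intro w hw
      rw [(absolutelyContinuousOnInterval_polynomial P 0 1).integral_mul_deriv_eq_deriv_mul
        (absolutelyContinuousOnInterval_of_lipschitzWith hw 0 1)]
      simp only [Polynomial.deriv]
    simp only [ibp _ (hu _), ibp _ hv]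
    exact (((h.tendsto_at ⟨zero_le_one, le_rfl⟩).const_mul _).sub
      ((h.tendsto_at ⟨le_rfl, zero_le_one⟩).const_mul _)).sub
      (tendsto_integral_mul_of_tendstoUniformlyOn P.derivative.continuous
        (fun i => (hu i).continuous) hv.continuous h)
  rw [Metric.tendsto_nhds]
  intro ε hε
  obtain ⟨P, hP⟩ := exists_polynomial_integral_abs_sub_le hg
    (show 0 < ε / (4 * (K + 1)) by positivity)
  have hgP := hg.sub (P.continuous.intervalIntegrable (μ := volume) 0 1)
  have est : ∀ w : ℝ → ℝ, LipschitzWith K w →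
      |(∫ t in (0 : ℝ)..1, g t * deriv w t) - ∫ t in (0 : ℝ)..1, P.eval t * deriv w t| ≤
        ε / 4 := by
    intro w hw
    have hdw : ∀ t, |deriv w t| ≤ K := fun t => norm_deriv_le_of_lipschitz hw
    have hi : ∀ f : ℝ → ℝ, IntervalIntegrable f volume 0 1 →
        IntervalIntegrable (fun t => f t * deriv w t) volume 0 1 := fun f hf =>
      intervalIntegrable_mul_of_abs_le hf (measurable_deriv w) hdw
    rw [← intervalIntegral.integral_sub (hi _ hg) (hi _ (P.continuous.intervalIntegrable _ _))]
    simp only [← sub_mul]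
    refine (abs_integral_mul_le hdw hgP).trans ?_
    calc _ ≤ ε / (4 * (K + 1)) * K := by gcongr
      _ ≤ ε / (4 * (K + 1)) * (K + 1) := by gcongr; linarith
      _ = ε / 4 := by field_simp
  filter_upwards [Metric.tendsto_nhds.1 (poly P) (ε / 4) (by positivity)] with i hi
  rw [Real.dist_eq] at hi ⊢
  have h1 := abs_le.1 (est _ (hu i))
  have h2 := abs_le.1 (est _ hv)
  have h3 := abs_lt.1 hi
  rw [abs_lt]
  constructor <;> linarith [h1.1, h1.2, h2.1, h2.2, h3.1, h3.2]

variable {F : Plane → ℝ} {γ : ι → ℝ → Plane} {σ : ℝ → Plane} {K : NNReal}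

theorem tendstoUniformlyOn_coord (h : TendstoUniformlyOn γ σ l (Icc 0 1)) (j : Fin 2) :
    TendstoUniformlyOn (fun i t => γ i t j) (fun t => σ t j) l (Icc 0 1) := by
  rw [Metric.tendstoUniformlyOn_iff] at h ⊢
  intro ε hε
  filter_upwards [h ε hε] with i hi t ht
  refine lt_of_le_of_lt ?_ (hi t ht)
  rw [dist_eq_norm, dist_eq_norm]
  exact PiLp.norm_apply_le (σ t - γ i t) j

theorem tendsto_area (hγ : ∀ i, LipschitzWith K (γ i)) (hσ : LipschitzWith K σ)
    (h : TendstoUniformlyOn γ σ l (Icc 0 1)) :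
    Tendsto (fun i => area (γ i)) l (𝓝 (area σ)) := by
  refine Tendsto.neg ?_
  have h1 := tendsto_integral_mul_deriv
    ((lipschitzWith_coord hσ 1).continuous.intervalIntegrable 0 1)
    (fun i => lipschitzWith_coord (hγ i) 0) (lipschitzWith_coord hσ 0)
    (tendstoUniformlyOn_coord h 0)
  have h2 : Tendsto (fun i => ∫ t in (0 : ℝ)..1,
      (γ i t 1 - σ t 1) * deriv (fun s => γ i s 0) t) l (𝓝 0) := by
    rw [Metric.tendsto_nhds]
    intro ε hε
    filter_upwards [Metric.tendstoUniformlyOn_iff.1 (tendstoUniformlyOn_coord h 1)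
      (ε / (K + 1)) (by positivity)] with i hi
    rw [Real.dist_eq, sub_zero]
    refine lt_of_le_of_lt (abs_integral_mul_le_of_abs_le (C := K) (D := ε / (K + 1))
      (fun t => norm_deriv_le_of_lipschitz (lipschitzWith_coord (hγ i) 0)) fun t ht => ?_) ?_
    · have := (hi t ht).le
      rwa [dist_comm, Real.dist_eq] at this
    · rw [div_mul_eq_mul_div, div_lt_iff₀ (by positivity)]
      nlinarith [K.2]
  have h3 := h2.add h1
  rw [zero_add] at h3
  refine h3.congr fun i => ?_
  have hi := intervalIntegrable_deriv (lipschitzWith_coord (hγ i) 0) 0 1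
  have hc : Continuous fun t => γ i t 1 - σ t 1 :=
    (lipschitzWith_coord (hγ i) 1).continuous.sub (lipschitzWith_coord hσ 1).continuous
  rw [← intervalIntegral.integral_add (hi.continuousOn_mul hc.continuousOn)
    (hi.continuousOn_mul (lipschitzWith_coord hσ 1).continuous.continuousOn)]
  congr 1
  ext t
  ring

theorem integral_mul_norm_deriv_le (hF0 : ∀ x, 0 ≤ F x) (hF : Continuous F) [l.NeBot]
    (hγ : ∀ i, LipschitzWith K (γ i)) (hσ : LipschitzWith K σ)
    (h : TendstoUniformlyOn γ σ l (Icc 0 1)) {e : ℝ}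
    (he : Tendsto (fun i => ∫ t in (0 : ℝ)..1, F (σ t) * ‖deriv (γ i) t‖) l (𝓝 e)) :
    energy F σ ≤ e := by
  set n : ℝ → Plane := fun t => ‖deriv σ t‖⁻¹ • deriv σ t with hn
  have hn1 : ∀ t, ‖n t‖ ≤ 1 := fun t => by
    rw [hn, norm_smul, norm_inv, norm_norm]
    exact inv_mul_le_one
  have hnm : Measurable n := (measurable_deriv σ).norm.inv.smul (measurable_deriv σ)
  have hFσ : Continuous fun t => F (σ t) := hF.comp hσ.continuous
  have hnj : ∀ j, Measurable fun t => n t j := fun j =>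
    (EuclideanSpace.proj (𝕜 := ℝ) j).continuous.measurable.comp hnm
  have hg : ∀ j, IntervalIntegrable (fun t => F (σ t) * n t j) volume 0 1 := fun j =>
    intervalIntegrable_mul_of_abs_le (hFσ.intervalIntegrable 0 1) (hnj j)
      fun t => (PiLp.norm_apply_le (n t) j).trans (hn1 t)
  have hlim := (tendsto_integral_mul_deriv (hg 0) (fun i => lipschitzWith_coord (hγ i) 0)
    (lipschitzWith_coord hσ 0) (tendstoUniformlyOn_coord h 0)).add
    (tendsto_integral_mul_deriv (hg 1) (fun i => lipschitzWith_coord (hγ i) 1)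
    (lipschitzWith_coord hσ 1) (tendstoUniformlyOn_coord h 1))
  have hint : ∀ τ : ℝ → Plane, LipschitzWith K τ → ∀ j,
      IntervalIntegrable (fun t => F (σ t) * n t j * deriv (fun s => τ s j) t) volume 0 1 :=
    fun τ hτ j => intervalIntegrable_mul_of_abs_le (hg j) (measurable_deriv _)
      fun t => norm_deriv_le_of_lipschitz (lipschitzWith_coord hτ j)
  have hsum : ∀ τ : ℝ → Plane, LipschitzWith K τ →
      (∫ t in (0 : ℝ)..1, F (σ t) * n t 0 * deriv (fun s => τ s 0) t) +
        (∫ t in (0 : ℝ)..1, F (σ t) * n t 1 * deriv (fun s => τ s 1) t) =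
      ∫ t in (0 : ℝ)..1, F (σ t) * inner ℝ (n t) (deriv τ t) := by
    intro τ hτ
    rw [← intervalIntegral.integral_add (hint τ hτ 0) (hint τ hτ 1)]
    refine intervalIntegral.integral_congr_ae ?_
    filter_upwards [hτ.ae_differentiableAt_real] with t ht _
    rw [deriv_coord ht, deriv_coord ht, PiLp.inner_apply, Fin.sum_univ_two]
    simp only [RCLike.inner_apply, conj_trivial]
    ring
  simp only [hsum _ (hγ _), hsum _ hσ] at hlim
  have hE : energy F σ = ∫ t in (0 : ℝ)..1, F (σ t) * inner ℝ (n t) (deriv σ t) := by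
    refine intervalIntegral.integral_congr fun t _ => ?_
    simp only [hn, inner_smul_left, real_inner_self_eq_norm_sq, conj_trivial]
    rcases eq_or_ne ‖deriv σ t‖ 0 with h0 | h0
    · simp [h0]
    · field_simp
  rw [hE]
  refine le_of_tendsto_of_tendsto' hlim he fun i => ?_
  have hin : IntervalIntegrable (fun t => F (σ t) * inner ℝ (n t) (deriv (γ i) t)) volume 0 1 :=
    intervalIntegrable_mul_of_abs_le (C := K) (hFσ.intervalIntegrable 0 1)
      (hnm.inner (measurable_deriv _)) fun t => (abs_real_inner_le_norm _ _).trans (by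
        have := norm_deriv_le_of_lipschitz (x₀ := t) (hγ i)
        nlinarith [hn1 t, norm_nonneg (deriv (γ i) t), norm_nonneg (n t)])
  refine intervalIntegral.integral_mono_on zero_le_one hin
    ((intervalIntegrable_norm_deriv (hγ i) 0 1).continuousOn_mul hFσ.continuousOn)
    fun t _ => mul_le_mul_of_nonneg_left ?_ (hF0 _)
  refine (real_inner_le_norm _ _).trans ?_
  exact mul_le_of_le_one_left (norm_nonneg _) (hn1 t)

theorem energy_le_of_tendsto (hF0 : ∀ x, 0 ≤ F x) (hF : Continuous F) [l.NeBot]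
    (hγ : ∀ i, LipschitzWith K (γ i)) (hσ : LipschitzWith K σ) {x : Plane} {r : ℝ}
    (hγr : ∀ i, MapsTo (γ i) (Icc 0 1) (Metric.closedBall x r))
    (hσr : MapsTo σ (Icc 0 1) (Metric.closedBall x r))
    (h : TendstoUniformlyOn γ σ l (Icc 0 1)) {e : ℝ}
    (he : Tendsto (fun i => energy F (γ i)) l (𝓝 e)) : energy F σ ≤ e := by
  refine integral_mul_norm_deriv_le hF0 hF hγ hσ h ?_
  have hd : Tendsto (fun i => ∫ t in (0 : ℝ)..1, (F (σ t) - F (γ i t)) * ‖deriv (γ i) t‖) l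
      (𝓝 0) := by
    rw [Metric.tendsto_nhds]
    intro ε hε
    have huc := (isCompact_closedBall x r).uniformContinuousOn_of_continuous hF.continuousOn
    obtain ⟨δ, hδ, hFδ⟩ := Metric.uniformContinuousOn_iff.1 huc (ε / (K + 1)) (by positivity)
    filter_upwards [Metric.tendstoUniformlyOn_iff.1 h δ hδ] with i hi
    rw [Real.dist_eq, sub_zero]
    refine lt_of_le_of_lt (abs_integral_mul_le_of_abs_le (C := K) (D := ε / (K + 1))
      (fun t => ?_) fun t ht => ?_) ?_
    · rw [abs_norm]
      exact norm_deriv_le_of_lipschitz (hγ i)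
    · have := (hFδ _ (hσr ht) _ (hγr i ht) (hi t ht)).le
      rwa [Real.dist_eq] at this
    · rw [div_mul_eq_mul_div, div_lt_iff₀ (by positivity)]
      nlinarith [K.2]
  have h3 := hd.add he
  rw [zero_add] at h3
  refine h3.congr fun i => ?_
  have hi := intervalIntegrable_norm_deriv (hγ i) 0 1
  have hFσ : Continuous fun t => F (σ t) := hF.comp hσ.continuous
  have hFγ : Continuous fun t => F (γ i t) := hF.comp (hγ i).continuous
  have hc : Continuous fun t => F (σ t) - F (γ i t) := hFσ.sub hFγ
  rw [energy, ← intervalIntegral.integral_add (hi.continuousOn_mul hc.continuousOn)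
    (hi.continuousOn_mul hFγ.continuousOn)]
  congr 1
  ext t
  ring

theorem tendstoUniformlyOn_of_tendsto (hγ : ∀ i, LipschitzWith K (γ i)) (hσ : LipschitzWith K σ)
    (h : ∀ t, Tendsto (fun i => γ i t) l (𝓝 (σ t))) : TendstoUniformlyOn γ σ l (Icc 0 1) := by
  rw [← tendstoLocallyUniformlyOn_iff_tendstoUniformlyOn_of_compact isCompact_Icc,
    Metric.tendstoLocallyUniformlyOn_iff]
  intro ε hε x _
  refine ⟨_, mem_nhdsWithin_of_mem_nhds (Metric.ball_mem_nhds x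
    (show 0 < ε / (4 * (K + 1)) by positivity)), ?_⟩
  filter_upwards [Metric.tendsto_nhds.1 (h x) (ε / 4) (by positivity)] with i hi y hy
  have hK : (K : ℝ) * dist y x ≤ ε / 4 := by
    calc (K : ℝ) * dist y x ≤ (K + 1) * (ε / (4 * (K + 1))) :=
          mul_le_mul (by linarith) (Metric.mem_ball.1 hy).le dist_nonneg (by positivity)
      _ = ε / 4 := by field_simp
  have h1 := (hγ i).dist_le_mul y x
  have h2 := hσ.dist_le_mul y x
  have h3 := dist_triangle4_right (σ y) (γ i y) (σ x) (γ i x)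
  rw [dist_comm (σ x)] at h3
  linarith

/-- Equi-Lipschitz curves with a common starting point converge along every ultrafilter. -/
theorem exists_limit_curve (𝒰 : Ultrafilter ι) {p : Plane} (hγ : ∀ i, LipschitzWith K (γ i))
    (hp : ∀ i, γ i 0 = p) : ∃ σ : ℝ → Plane, LipschitzWith K σ ∧ σ 0 = p ∧
      TendstoUniformlyOn γ σ 𝒰 (Icc 0 1) := by
  have hlim : ∀ t, ∃ x, Tendsto (fun i => γ i t) 𝒰 (𝓝 x) := by
    intro t
    obtain ⟨x, -, hx⟩ := (isCompact_closedBall p (K * |t|)).ultrafilter_le_nhds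
      (𝒰.map fun i => γ i t) (by
        rw [le_principal_iff]
        refine Filter.mem_map.2 (Eventually.of_forall fun i => ?_)
        have := (hγ i).dist_le_mul t 0
        rw [hp i] at this
        simpa using this)
    exact ⟨x, hx⟩
  choose σ hσ using hlim
  have hl : LipschitzWith K σ := LipschitzWith.of_dist_le_mul fun x y =>
    le_of_tendsto' ((hσ x).dist (hσ y)) fun i => (hγ i).dist_le_mul x y
  refine ⟨σ, hl, ?_, tendstoUniformlyOn_of_tendsto hγ hl hσ⟩
  refine tendsto_nhds_unique (hσ 0) ?_
  simp only [hp]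
  exact tendsto_const_nhds

end

section

variable {F : Plane → ℝ} {γ : ℝ → Plane} {K : NNReal} {U : Set Plane} {p q w : Plane}
  {a b c A C e : ℝ}

/-! ### Lower bounds for the energy -/

theorem integral_deriv_coord (h : LipschitzWith K γ) (a b : ℝ) (j : Fin 2) :
    ∫ t in a..b, deriv (fun s => γ s j) t = γ b j - γ a j :=
  (absolutelyContinuousOnInterval_of_lipschitzWith
    (lipschitzWith_coord h j) a b).integral_deriv_eq_sub

theorem integral_inner_deriv (h : LipschitzWith K γ) (v : Plane) (a b : ℝ) :
    ∫ t in a..b, inner ℝ v (deriv γ t) = inner ℝ v (γ b - γ a) := by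
  have hi : ∀ j, IntervalIntegrable (fun t => v j * deriv (fun s => γ s j) t) volume a b :=
    fun j => (intervalIntegrable_deriv (lipschitzWith_coord h j) a b).const_mul _
  have : inner ℝ v (γ b - γ a) = (∫ t in a..b, v 0 * deriv (fun s => γ s 0) t) +
      ∫ t in a..b, v 1 * deriv (fun s => γ s 1) t := by
    rw [intervalIntegral.integral_const_mul, intervalIntegral.integral_const_mul,
      integral_deriv_coord h, integral_deriv_coord h, PiLp.inner_apply, Fin.sum_univ_two]
    simp only [RCLike.inner_apply, conj_trivial, PiLp.sub_apply]
    ring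
  rw [this, ← intervalIntegral.integral_add (hi 0) (hi 1)]
  refine intervalIntegral.integral_congr_ae ?_
  filter_upwards [h.ae_differentiableAt_real] with t ht _
  rw [deriv_coord ht, deriv_coord ht, PiLp.inner_apply, Fin.sum_univ_two]
  simp only [RCLike.inner_apply, conj_trivial]
  ring

theorem intervalIntegrable_inner_deriv (h : LipschitzWith K γ) {u : ℝ → Plane}
    (hu : Continuous u) (a b : ℝ) :
    IntervalIntegrable (fun t => inner ℝ (u t) (deriv γ t)) volume a b := by
  refine (((intervalIntegrable_norm_deriv h a b).continuousOn_mul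
    hu.norm.continuousOn)).mono_fun
    (hu.measurable.inner (measurable_deriv γ)).aestronglyMeasurable
    (Eventually.of_forall fun t => ?_)
  simp only [norm_mul, norm_norm]
  exact abs_real_inner_le_norm _ _

theorem norm_sub_le_integral_norm_deriv (h : LipschitzWith K γ) (hab : a ≤ b) :
    ‖γ b - γ a‖ ≤ ∫ t in a..b, ‖deriv γ t‖ := by
  rcases eq_or_ne ‖γ b - γ a‖ 0 with h0 | h0
  · rw [h0]
    exact intervalIntegral.integral_nonneg hab fun _ _ => norm_nonneg _
  have h1 : ‖γ b - γ a‖ * ‖γ b - γ a‖ ≤ ‖γ b - γ a‖ * ∫ t in a..b, ‖deriv γ t‖ := by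
    rw [← real_inner_self_eq_norm_mul_norm, ← integral_inner_deriv h,
      ← intervalIntegral.integral_const_mul]
    exact intervalIntegral.integral_mono_on hab
      (intervalIntegrable_inner_deriv h continuous_const a b)
      ((intervalIntegrable_norm_deriv h a b).const_mul _) fun t _ => real_inner_le_norm _ _
  exact le_of_mul_le_mul_left h1 (lt_of_le_of_ne (norm_nonneg _) h0.symm)

theorem mul_arclength_le_energy (hF : Continuous F) (h : LipschitzWith K γ)
    (hc : MapsTo γ (Icc 0 1) {x | c ≤ F x}) : c * arclength γ ≤ energy F γ := by
  rw [arclength, energy, ← intervalIntegral.integral_const_mul]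
  exact intervalIntegral.integral_mono_on zero_le_one
    ((intervalIntegrable_norm_deriv h 0 1).const_mul _) (intervalIntegrable_energy hF h 0 1)
    fun t ht => mul_le_mul_of_nonneg_right (hc ht) (norm_nonneg _)

theorem ReachIn.mul_norm_sub_le (hF : Continuous F) (hc : 0 ≤ c)
    (h : ReachIn F {x | c ≤ F x} p q A e) : c * ‖q - p‖ ≤ e := by
  obtain ⟨γ, ⟨K, hK⟩, hU, rfl, rfl, -, hE⟩ := h
  exact (mul_le_mul_of_nonneg_left (norm_sub_le_integral_norm_deriv hK zero_le_one) hc).trans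
    ((mul_arclength_le_energy hF hK hU).trans hE)

theorem integral_inner_self_deriv (h : LipschitzWith K γ) (w : Plane) :
    ∫ t in (0 : ℝ)..1, inner ℝ (γ t - w) (deriv γ t) = (‖γ 1 - w‖ ^ 2 - ‖γ 0 - w‖ ^ 2) / 2 := by
  have hl : ∀ j, LipschitzWith K (fun t => γ t j - w j) := fun j => by
    simpa using (lipschitzWith_coord h j).sub (LipschitzWith.const (w j))
  have hi : ∀ j, IntervalIntegrable (fun t => (γ t j - w j) * deriv (fun s => γ s j - w j) t)
      volume 0 1 :=
    fun j => (intervalIntegrable_deriv (hl j) 0 1).continuousOn_mul (hl j).continuous.continuousOn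
  have hI : ∀ j, ∫ t in (0 : ℝ)..1, (γ t j - w j) * deriv (fun s => γ s j - w j) t =
      ((γ 1 j - w j) ^ 2 - (γ 0 j - w j) ^ 2) / 2 := fun j => by
    have hac := absolutelyContinuousOnInterval_of_lipschitzWith (hl j) 0 1
    have := hac.integral_mul_deriv_eq_deriv_mul hac
    simp only [mul_comm (deriv _ _)] at this
    linarith
  have hr : (‖γ 1 - w‖ ^ 2 - ‖γ 0 - w‖ ^ 2) / 2 =
      (∫ t in (0 : ℝ)..1, (γ t 0 - w 0) * deriv (fun s => γ s 0 - w 0) t) +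
      ∫ t in (0 : ℝ)..1, (γ t 1 - w 1) * deriv (fun s => γ s 1 - w 1) t := by
    rw [hI, hI, EuclideanSpace.real_norm_sq_eq, EuclideanSpace.real_norm_sq_eq,
      Fin.sum_univ_two, Fin.sum_univ_two]
    simp only [PiLp.sub_apply]
    ring
  rw [hr, ← intervalIntegral.integral_add (hi 0) (hi 1)]
  refine intervalIntegral.integral_congr_ae ?_
  filter_upwards [h.ae_differentiableAt_real] with t ht _
  rw [deriv_sub_const, deriv_sub_const, deriv_coord ht, deriv_coord ht, PiLp.inner_apply,
    Fin.sum_univ_two]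
  simp only [RCLike.inner_apply, conj_trivial, PiLp.sub_apply]
  ring

theorem ReachIn.mul_sq_sub_sq_le (hF : Continuous F) (hc : 0 ≤ c)
    (h : ReachIn F {x | c * ‖x - w‖ ≤ F x} p q A e) :
    c * (‖q - w‖ ^ 2 - ‖p - w‖ ^ 2) / 2 ≤ e := by
  obtain ⟨γ, ⟨K, hK⟩, hU, rfl, rfl, -, hE⟩ := h
  refine le_trans ?_ hE
  rw [mul_div_assoc, ← integral_inner_self_deriv hK, ← intervalIntegral.integral_const_mul]
  refine intervalIntegral.integral_mono_on zero_le_one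
    ((intervalIntegrable_inner_deriv hK (hK.continuous.sub continuous_const) 0 1).const_mul c)
    (intervalIntegrable_energy hF hK 0 1) fun t ht => ?_
  have h1 := mul_le_mul_of_nonneg_left (real_inner_le_norm (γ t - w) (deriv γ t)) hc
  have h2 := mul_le_mul_of_nonneg_right (hU ht) (norm_nonneg (deriv γ t))
  linarith

theorem ReachIn.abs_area_le (hF : Continuous F) (hC : 0 ≤ C)
    (h : ReachIn F {x | |x 1 - w 1| ≤ C * F x} p q A e) :
    |A| ≤ C * e + |w 1| * |q 0 - p 0| := by
  obtain ⟨γ, ⟨K, hK⟩, hU, rfl, rfl, rfl, hE⟩ := h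
  have hd := intervalIntegrable_deriv (lipschitzWith_coord hK 0) 0 1
  have hc : Continuous fun t => γ t 1 - w 1 :=
    (lipschitzWith_coord hK 1).continuous.sub continuous_const
  have h1 : area γ = -(∫ t in (0 : ℝ)..1, (γ t 1 - w 1) * deriv (fun s => γ s 0) t) -
      w 1 * (γ 1 0 - γ 0 0) := by
    rw [← integral_deriv_coord hK, ← intervalIntegral.integral_const_mul, area, ← neg_add',
      ← intervalIntegral.integral_add (hd.continuousOn_mul hc.continuousOn) (hd.const_mul _)]
    congr 2
    ext t
    ring
  have h2 : |∫ t in (0 : ℝ)..1, (γ t 1 - w 1) * deriv (fun s => γ s 0) t| ≤ C * energy F γ := by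
    rw [energy, ← intervalIntegral.integral_const_mul, ← Real.norm_eq_abs]
    refine intervalIntegral.norm_integral_le_of_norm_le zero_le_one ?_
      ((intervalIntegrable_energy hF hK 0 1).const_mul C)
    filter_upwards [hK.ae_differentiableAt_real] with t ht htI
    have h3 : |γ t 1 - w 1| ≤ C * F (γ t) := hU (Ioc_subset_Icc_self htI)
    rw [norm_mul, deriv_coord ht, ← mul_assoc]
    exact mul_le_mul h3 (PiLp.norm_apply_le (deriv γ t) 0) (norm_nonneg _)
      ((abs_nonneg _).trans h3)
  rw [h1]
  refine (abs_sub _ _).trans ?_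
  rw [abs_neg, abs_mul]
  have := mul_le_mul_of_nonneg_left hE hC
  linarith

/-! ### Reparametrization -/

theorem ae_comp_of_lipschitzWith_rightInverse {s τ : ℝ → ℝ} (hs : LipschitzWith K s)
    (hsτ : Function.RightInverse τ s) {P : ℝ → Prop} (hP : ∀ᵐ t, P t) : ∀ᵐ x, P (τ x) := by
  rw [ae_iff] at hP ⊢
  refine measure_mono_null (t := s '' {t | ¬P t}) (fun x hx => ⟨τ x, hx, hsτ x⟩) ?_
  have := hs.hausdorffMeasure_image_le zero_le_one {t | ¬P t}
  rw [hausdorffMeasure_real, hP, mul_zero] at this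
  exact le_antisymm this zero_le

theorem integral_comp_mul_deriv_of_lipschitz {K' : NNReal} {s τ : ℝ → ℝ} (hs : LipschitzWith K s)
    (hτ : LipschitzWith K' τ) (hsτ : Function.RightInverse τ s) (hτm : MapsTo τ (Icc 0 1) (Icc 0 1))
    (h0 : τ 0 = 0) (h1 : τ 1 = 1) {φ : ℝ → ℝ} (hφ : IntervalIntegrable φ volume 0 1)
    (hC : ∀ t ∈ Icc (0 : ℝ) 1, |φ t| ≤ C) :
    ∫ x in (0 : ℝ)..1, φ (τ x) * deriv τ x = ∫ t in (0 : ℝ)..1, φ t := by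
  set H : ℝ → ℝ := fun x => ∫ t in (0 : ℝ)..x, φ t with hH
  have hC0 : 0 ≤ C := (abs_nonneg _).trans (hC 0 ⟨le_rfl, zero_le_one⟩)
  have hsub : ∀ x ∈ Icc (0 : ℝ) 1, ∀ y ∈ Icc (0 : ℝ) 1, uIcc x y ⊆ uIcc 0 1 := fun x hx y hy => by
    rw [uIcc_of_le zero_le_one]
    exact (convex_Icc (0 : ℝ) 1).ordConnected.uIcc_subset hx hy
  have hHl : LipschitzOnWith C.toNNReal H (Icc 0 1) := by
    refine LipschitzOnWith.of_dist_le_mul fun x hx y hy => ?_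
    have h00 : (0 : ℝ) ∈ Icc (0 : ℝ) 1 := ⟨le_rfl, zero_le_one⟩
    rw [Real.dist_eq, hH, intervalIntegral.integral_interval_sub_left
      (hφ.mono_set (hsub _ h00 _ hx)) (hφ.mono_set (hsub _ h00 _ hy)), Real.coe_toNNReal _ hC0,
      Real.dist_eq]
    refine intervalIntegral.norm_integral_le_of_norm_le_const fun t ht =>
      (Real.norm_eq_abs (φ t)).trans_le (hC t ?_)
    have := hsub _ hy _ hx (uIoc_subset_uIcc ht)
    rwa [uIcc_of_le zero_le_one] at this
  have hac : AbsolutelyContinuousOnInterval (H ∘ τ) 0 1 := by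
    have := hHl.comp hτ.lipschitzOnWith hτm
    rw [← uIcc_of_le (zero_le_one' ℝ)] at this
    exact this.absolutelyContinuousOnInterval
  have hint := hac.integral_deriv_eq_sub
  simp only [Function.comp, h0, h1, hH, intervalIntegral.integral_same, sub_zero] at hint
  rw [← hint]
  refine intervalIntegral.integral_congr_ae ?_
  filter_upwards [ae_comp_of_lipschitzWith_rightInverse hs hsτ hφ.ae_hasDerivAt_integral,
    hτ.ae_differentiableAt_real] with x hx hτx hxI
  rw [uIoc_of_le zero_le_one] at hxI
  rw [uIcc_of_le zero_le_one] at hx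
  exact (((hx (hτm (Ioc_subset_Icc_self hxI)) 0 ⟨le_rfl, zero_le_one⟩).comp x
    hτx.hasDerivAt).deriv).symm

theorem energy_area_comp {K' L : NNReal} {s τ : ℝ → ℝ} (hF : Continuous F)
    (hγ : LipschitzWith L γ) (hs : LipschitzWith K s)
    (hτ : LipschitzWith K' τ) (hsτ : Function.RightInverse τ s) (hτm : MapsTo τ (Icc 0 1) (Icc 0 1))
    (h0 : τ 0 = 0) (h1 : τ 1 = 1) (hmono : Monotone τ) :
    energy F (γ ∘ τ) = energy F γ ∧ area (γ ∘ τ) = area γ := by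
  have key : ∀ᵐ x, HasDerivAt (γ ∘ τ) (deriv τ x • deriv γ (τ x)) x ∧
      DifferentiableAt ℝ γ (τ x) := by
    filter_upwards [ae_comp_of_lipschitzWith_rightInverse hs hsτ hγ.ae_differentiableAt_real,
      hτ.ae_differentiableAt_real] with x hx hτx
    exact ⟨hx.hasDerivAt.scomp x hτx.hasDerivAt, hx⟩
  constructor
  · obtain ⟨C, hC⟩ := (isCompact_Icc (a := (0 : ℝ)) (b := 1)).exists_bound_of_continuousOn
      (hF.comp hγ.continuous).continuousOn
    rw [energy, energy, ← integral_comp_mul_deriv_of_lipschitz hs hτ hsτ hτm h0 h1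
      (intervalIntegrable_energy hF hγ 0 1) (C := C * L) fun t ht => ?_]
    · refine intervalIntegral.integral_congr_ae ?_
      filter_upwards [key] with x hx _
      rw [hx.1.deriv, norm_smul, Real.norm_of_nonneg (hmono.deriv_nonneg (x := x))]
      simp only [Function.comp]
      ring
    · rw [abs_mul, abs_norm]
      exact mul_le_mul (hC t ht) (norm_deriv_le_of_lipschitz hγ) (norm_nonneg _)
        ((norm_nonneg _).trans (hC t ht))
  · obtain ⟨C, hC⟩ := (isCompact_Icc (a := (0 : ℝ)) (b := 1)).exists_bound_of_continuousOn
      (lipschitzWith_coord hγ 1).continuous.continuousOn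
    rw [area, area, ← integral_comp_mul_deriv_of_lipschitz hs hτ hsτ hτm h0 h1
      (intervalIntegrable_area hγ 0 1) (C := C * L) fun t ht => ?_]
    · refine congrArg _ (intervalIntegral.integral_congr_ae ?_)
      filter_upwards [key] with x hx _
      rw [deriv_coord hx.1.differentiableAt, hx.1.deriv, deriv_coord hx.2]
      simp only [Function.comp, PiLp.smul_apply, smul_eq_mul]
      ring
    · rw [abs_mul]
      exact mul_le_mul (hC t ht) (norm_deriv_le_of_lipschitz (lipschitzWith_coord hγ 0))
        (abs_nonneg _) ((norm_nonneg _).trans (hC t ht))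

/-- A Lipschitz curve may be reparametrized so that its speed is at most its arclength plus one. -/
theorem exists_reparametrization {L : NNReal} (hF : Continuous F) (hγ : LipschitzWith L γ) :
    ∃ σ : ℝ → Plane, LipschitzWith (arclength γ + 1).toNNReal σ ∧ σ 0 = γ 0 ∧ σ 1 = γ 1 ∧
      energy F σ = energy F γ ∧ area σ = area γ := by
  set ℓ := arclength γ with hℓ
  have hℓ0 : 0 ≤ ℓ := intervalIntegral.integral_nonneg zero_le_one fun _ _ => norm_nonneg _
  have hpos : 0 < ℓ + 1 := by linarith
  have hint : ∀ a b, IntervalIntegrable (fun t => ‖deriv γ t‖ + 1) volume a b := fun a b =>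
    (intervalIntegrable_norm_deriv hγ a b).add intervalIntegrable_const
  set s : ℝ → ℝ := fun x => (∫ t in (0 : ℝ)..x, (‖deriv γ t‖ + 1)) / (ℓ + 1) with hs
  have hdiff : ∀ a b, s b - s a = (∫ t in a..b, (‖deriv γ t‖ + 1)) / (ℓ + 1) := fun a b => by
    rw [hs, ← sub_div, intervalIntegral.integral_interval_sub_left (hint _ _) (hint _ _)]
  have hsplit : ∀ a b, ∫ t in a..b, (‖deriv γ t‖ + 1) =
      (∫ t in a..b, ‖deriv γ t‖) + (b - a) := fun a b => by
    rw [intervalIntegral.integral_add (intervalIntegrable_norm_deriv hγ a b)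
      intervalIntegrable_const]
    simp
  have hnn : ∀ {a b : ℝ}, a ≤ b → 0 ≤ ∫ t in a..b, ‖deriv γ t‖ := fun hab =>
    intervalIntegral.integral_nonneg hab fun _ _ => norm_nonneg _
  have hlow : ∀ {a b : ℝ}, a ≤ b → b - a ≤ (ℓ + 1) * (s b - s a) := fun {a b} hab => by
    rw [hdiff, mul_div_cancel₀ _ hpos.ne', hsplit]
    linarith [hnn hab]
  have hspeed : ∀ {a b : ℝ}, a ≤ b → ‖γ b - γ a‖ ≤ (ℓ + 1) * (s b - s a) := fun {a b} hab => by
    rw [hdiff, mul_div_cancel₀ _ hpos.ne', hsplit]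
    linarith [norm_sub_le_integral_norm_deriv hγ hab]
  have hs0 : s 0 = 0 := by simp [hs]
  have hs1 : s 1 = 1 := by
    have := hdiff 0 1
    rw [hs0, hsplit, sub_zero, sub_zero] at this
    rw [this]
    exact div_self hpos.ne'
  have hmono : StrictMono s := fun a b hab => by
    have := hlow hab.le
    by_contra hcon
    nlinarith
  have hlip : LipschitzWith ((L + 1) / (ℓ + 1)).toNNReal s := by
    refine LipschitzWith.of_dist_le_mul fun x y => ?_
    rw [Real.coe_toNNReal _ (by positivity), Real.dist_eq, hdiff, abs_div, abs_of_pos hpos,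
      div_mul_eq_mul_div, Real.dist_eq]
    gcongr
    refine intervalIntegral.norm_integral_le_of_norm_le_const (f := fun t => ‖deriv γ t‖ + 1)
      fun t _ => ?_
    rw [Real.norm_of_nonneg (by positivity)]
    linarith [norm_deriv_le_of_lipschitz (x₀ := t) hγ]
  have hanti : AntilipschitzWith (ℓ + 1).toNNReal s := by
    refine AntilipschitzWith.of_le_mul_dist fun x y => ?_
    rw [Real.coe_toNNReal _ hpos.le, Real.dist_eq, Real.dist_eq]
    rcases le_total x y with h | h
    · rw [abs_sub_comm, abs_of_nonneg (by linarith), abs_sub_comm,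
        abs_of_nonneg (sub_nonneg.2 (hmono.monotone h))]
      exact hlow h
    · rw [abs_of_nonneg (by linarith), abs_of_nonneg (sub_nonneg.2 (hmono.monotone h))]
      exact hlow h
  have hsurj : Function.Surjective s := by
    refine hlip.continuous.surjective ?_ ?_
    · refine tendsto_atTop_mono' _ ?_ (tendsto_id.atTop_div_const hpos)
      filter_upwards [eventually_ge_atTop 0] with x hx
      have := hlow hx
      rw [hs0] at this
      rw [id, div_le_iff₀ hpos]
      linarith
    · refine tendsto_atBot_mono' _ ?_ (tendsto_id.atBot_div_const hpos)
      filter_upwards [eventually_le_atBot 0] with x hx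
      have := hlow hx
      rw [hs0] at this
      rw [id, le_div_iff₀ hpos]
      linarith
  obtain ⟨τ, hτ⟩ := hsurj.hasRightInverse
  have hτl := hanti.to_rightInverse hτ
  have hτm : Monotone τ := fun x y hxy => by
    rw [← hmono.le_iff_le, hτ, hτ]
    exact hxy
  have hτ0 : τ 0 = 0 := hmono.injective (by rw [hτ, hs0])
  have hτ1 : τ 1 = 1 := hmono.injective (by rw [hτ, hs1])
  have hmaps : MapsTo τ (Icc 0 1) (Icc 0 1) := fun x hx =>
    ⟨hτ0 ▸ hτm hx.1, hτ1 ▸ hτm hx.2⟩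
  have hEA := energy_area_comp hF hγ hlip hτl hτ hmaps hτ0 hτ1 hτm
  refine ⟨γ ∘ τ, ?_, by simp [hτ0], by simp [hτ1], hEA.1, hEA.2⟩
  refine LipschitzWith.of_dist_le_mul fun x y => ?_
  rw [Real.coe_toNNReal _ hpos.le, dist_eq_norm, Real.dist_eq]
  rcases le_total x y with h | h
  · rw [norm_sub_rev, abs_sub_comm, abs_of_nonneg (by linarith)]
    simpa only [Function.comp, hτ x, hτ y] using hspeed (hτm h)
  · rw [abs_of_nonneg (by linarith)]
    simpa only [Function.comp, hτ x, hτ y] using hspeed (hτm h)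

/-! ### Compactness away from the wells -/

/-- Limits of curves along which the conformal factor is bounded below are attained. -/
theorem reachIn_univ_of_tendsto {ι : Type*} (𝒰 : Ultrafilter ι) (hF : Continuous F)
    (hF0 : ∀ x, 0 ≤ F x) (hc : 0 < c) {Q : ι → Plane} {α E : ι → ℝ}
    (h : ∀ᶠ i in 𝒰, ReachIn F {x | c ≤ F x} p (Q i) (α i) (E i))
    (hQ : Tendsto Q 𝒰 (𝓝 q)) (hα : Tendsto α 𝒰 (𝓝 A)) (hE : Tendsto E 𝒰 (𝓝 e)) :
    ReachIn F univ p q A e := by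
  set M : NNReal := ((e + 1) / c + 1).toNNReal with hM
  have hE1 : ∀ᶠ i in 𝒰, E i ≤ e + 1 := hE.eventually_le_const (lt_add_one e)
  have hex : ∀ i, ∃ σ : ℝ → Plane, LipschitzWith M σ ∧ σ 0 = p ∧
      (ReachIn F {x | c ≤ F x} p (Q i) (α i) (E i) ∧ E i ≤ e + 1 →
        σ 1 = Q i ∧ area σ = α i ∧ energy F σ ≤ E i) := by
    intro i
    by_cases hi : ReachIn F {x | c ≤ F x} p (Q i) (α i) (E i) ∧ E i ≤ e + 1
    · obtain ⟨⟨γ, ⟨L, hL⟩, hU, h0, h1, hA, hEi⟩, hle⟩ := hi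
      obtain ⟨σ, hσ, hσ0, hσ1, hσE, hσA⟩ := exists_reparametrization hF hL
      refine ⟨σ, hσ.weaken (Real.toNNReal_le_toNNReal ?_), hσ0.trans h0, fun _ =>
        ⟨hσ1.trans h1, hσA.trans hA, hσE.trans_le hEi⟩⟩
      have := (mul_arclength_le_energy hF hL hU).trans (hEi.trans hle)
      gcongr
      rw [le_div_iff₀ hc]
      linarith
    · exact ⟨fun _ => p, (LipschitzWith.const p).weaken zero_le, rfl, fun h => absurd h hi⟩
  choose γ hγ h0 hprop using hex
  obtain ⟨σ, hσ, hσ0, hlim⟩ := exists_limit_curve 𝒰 hγ h0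
  have hev : ∀ᶠ i in 𝒰, γ i 1 = Q i ∧ area (γ i) = α i ∧ energy F (γ i) ≤ E i := by
    filter_upwards [h, hE1] with i hi1 hi2 using hprop i ⟨hi1, hi2⟩
  have hball : ∀ τ : ℝ → Plane, LipschitzWith M τ → τ 0 = p →
      MapsTo τ (Icc 0 1) (Metric.closedBall p M) := fun τ hτ hτ0 t ht => by
    have := hτ.dist_le_mul t 0
    rw [hτ0, Real.dist_eq, sub_zero, abs_of_nonneg ht.1] at this
    exact this.trans (mul_le_of_le_one_right M.2 ht.2)
  refine ⟨σ, ⟨M, hσ⟩, mapsTo_univ _ _, hσ0, ?_, ?_, ?_⟩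
  · exact tendsto_nhds_unique_of_eventuallyEq (hlim.tendsto_at ⟨zero_le_one, le_rfl⟩) hQ
      (hev.mono fun i hi => hi.1)
  · exact tendsto_nhds_unique_of_eventuallyEq (tendsto_area hγ hσ hlim) hα
      (hev.mono fun i hi => hi.2.1)
  · have hbd : ∀ᶠ i in 𝒰, energy F (γ i) ∈ Icc 0 (e + 1) := by
      filter_upwards [hev, hE1] with i hi hi1
      exact ⟨energyOn_nonneg (γ := γ i) hF0 zero_le_one, hi.2.2.trans hi1⟩
    obtain ⟨e', -, he'⟩ := isCompact_Icc.ultrafilter_le_nhds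
      (𝒰.map fun i => energy F (γ i)) (le_principal_iff.2 hbd)
    refine (energy_le_of_tendsto hF0 hF hγ hσ (fun i => hball _ (hγ i) (h0 i))
      (hball σ hσ hσ0) hlim he').trans ?_
    exact le_of_tendsto_of_tendsto he' hE (hev.mono fun i hi => hi.2.2)

end

section

variable {F W : Plane → ℝ} {γ : ℝ → Plane} {K : NNReal} {U B : Set Plane} {p q s w z : Plane}
  {a b c A C e R ε : ℝ} {ι : Type*}

/-! ### Cutting curves -/

theorem ReachIn.left_mem (h : ReachIn F U p q A e) : p ∈ U := by
  obtain ⟨γ, -, hU, rfl, -⟩ := h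
  exact hU ⟨le_rfl, zero_le_one⟩

theorem ReachIn.right_mem (h : ReachIn F U p q A e) : q ∈ U := by
  obtain ⟨γ, -, hU, -, rfl, -⟩ := h
  exact hU ⟨zero_le_one, le_rfl⟩

theorem reachIn_cut {V V' : Set Plane} (hF : Continuous F) (hK : LipschitzWith K γ) {t : ℝ}
    (ht : t ∈ Icc (0 : ℝ) 1) (hV : MapsTo γ (Icc 0 t) V) (hV' : MapsTo γ (Icc t 1) V')
    (hE : energy F γ ≤ e) : ∃ A₁ e₁, ReachIn F V (γ 0) (γ t) A₁ e₁ ∧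
      ReachIn F V' (γ t) (γ 1) (area γ - A₁) (e - e₁) := by
  refine ⟨_, _, reachIn_of_interval hK ht.1 hV, ?_⟩
  have h := reachIn_of_interval (F := F) hK ht.2 hV'
  have h1 := areaOn_add hK 0 t 1
  have h2 := energyOn_add hF hK 0 t 1
  rw [areaOn_zero_one] at h1
  rw [energyOn_zero_one] at h2
  rw [← h1, add_sub_cancel_left]
  exact h.mono subset_rfl (by linarith)

/-- A curve that starts off a closed set `T` either avoids `T` or may be cut where it first meets
`T`. -/
theorem ReachIn.first_hit (hF : Continuous F) {T : Set Plane} (hT : IsClosed T) (hp : p ∉ T)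
    (h : ReachIn F U p q A e) : ReachIn F Tᶜ p q A e ∨
      ∃ z ∈ T ∩ closure Tᶜ, ∃ A₁ e₁, ReachIn F (closure Tᶜ) p z A₁ e₁ ∧
        ReachIn F U z q (A - A₁) (e - e₁) := by
  obtain ⟨γ, ⟨K, hK⟩, hU, rfl, rfl, rfl, hE⟩ := h
  by_cases hne : (Icc (0 : ℝ) 1 ∩ γ ⁻¹' T).Nonempty
  · right
    have hc : IsCompact (Icc (0 : ℝ) 1 ∩ γ ⁻¹' T) :=
      isCompact_Icc.inter_right (hT.preimage hK.continuous)
    set t := sInf (Icc (0 : ℝ) 1 ∩ γ ⁻¹' T) with ht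
    have htm : t ∈ Icc (0 : ℝ) 1 ∩ γ ⁻¹' T := hc.sInf_mem hne
    have ht0 : t ≠ 0 := fun h0 => hp (h0 ▸ htm.2)
    have hbefore : MapsTo γ (Ico 0 t) Tᶜ := fun x hx hxT =>
      (csInf_le hc.bddBelow ⟨⟨hx.1, hx.2.le.trans htm.1.2⟩, hxT⟩).not_gt hx.2
    have hcl : MapsTo γ (Icc 0 t) (closure Tᶜ) := by
      rw [← closure_Ico ht0.symm]
      exact hbefore.closure hK.continuous
    exact ⟨γ t, ⟨htm.2, hcl ⟨htm.1.1, le_rfl⟩⟩, reachIn_cut hF hK htm.1 hcl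
      (fun x hx => hU ⟨htm.1.1.trans hx.1, hx.2⟩) hE⟩
  · left
    exact ⟨γ, ⟨K, hK⟩, fun t ht htT => hne ⟨t, ht, htT⟩, rfl, rfl, rfl, hE⟩

/-- A curve may be cut at a point nearest to a given point `w`. -/
theorem ReachIn.nearest (hF : Continuous F) (w : Plane) (h : ReachIn F U p q A e) :
    ∃ z ∈ U, ∃ A₁ e₁, ReachIn F (U ∩ {x | ‖z - w‖ ≤ ‖x - w‖}) p q A e ∧
      ReachIn F U p z A₁ e₁ ∧ ReachIn F U z q (A - A₁) (e - e₁) := by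
  obtain ⟨γ, ⟨K, hK⟩, hU, rfl, rfl, rfl, hE⟩ := h
  obtain ⟨t, ht, hmin⟩ := (isCompact_Icc (a := (0 : ℝ)) (b := 1)).exists_isMinOn
    ⟨0, le_rfl, zero_le_one⟩ (f := fun t => ‖γ t - w‖)
    (hK.continuous.sub continuous_const).norm.continuousOn
  obtain ⟨A₁, e₁, h1, h2⟩ := reachIn_cut (V := U) (V' := U) hF hK ht
    (fun x hx => hU ⟨hx.1, hx.2.trans ht.2⟩) (fun x hx => hU ⟨ht.1.trans hx.1, hx.2⟩) hE
  exact ⟨γ t, hU ht, A₁, e₁, ⟨γ, ⟨K, hK⟩, fun x hx => ⟨hU hx, hmin hx⟩, rfl, rfl, rfl, hE⟩,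
    h1, h2⟩

/-! ### Curves near a well -/

/-- Limits of curves ending near the well are dominated by the one-well minimizer. -/
theorem reachIn_well_of_tendsto {l : Filter ι} [l.NeBot] (hF : Continuous F)
    (hF0 : ∀ x, 0 ≤ F x) (hB : IsOpen B) (hp : p ∈ B) (hw : w ∈ B)
    (hmin : ∃ σ, IsMinimizer F (oneWellClass B p w A) σ) {P X : ι → Plane} {α E : ι → ℝ}
    (h : ∀ᶠ i in l, ReachIn F B (P i) (X i) (α i) (E i)) (hP : Tendsto P l (𝓝 p))
    (hX : Tendsto X l (𝓝 w)) (hα : Tendsto α l (𝓝 A)) (hE : Tendsto E l (𝓝 e)) :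
    ReachIn F univ p w A e := by
  obtain ⟨σ, ⟨⟨K, hK⟩, hU, h0, h1, hA⟩, hle⟩ := hmin
  have hσ := reachIn_of_lipschitzOnWith (F := F) hK (mapsTo_univ _ _)
  rw [h0, h1, hA] at hσ
  refine hσ.mono subset_rfl (le_of_forall_pos_le_add fun ε hε => ?_)
  have hε3 : 0 < ε / 3 := by positivity
  have c1 : ∀ᶠ i in l, ReachIn F B p (P i) 0 (ε / 3) :=
    (hP.prodMk_nhds (tendsto_const_nhds (x := (0 : ℝ)))).eventually
      (eventually_reachIn hF hF0 (hB.mem_nhds hp) hε3)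
  have hα0 : Tendsto (fun i => α i - A) l (𝓝 0) := by simpa using hα.sub_const A
  have c2 : ∀ᶠ i in l, ReachIn F B w (X i) (α i - A) (ε / 3) :=
    (hX.prodMk_nhds hα0).eventually (eventually_reachIn hF hF0 (hB.mem_nhds hw) hε3)
  obtain ⟨i, hi, h1, h2, h3⟩ := (h.and (c1.and (c2.and
    (hE.eventually_le_const (lt_add_of_pos_right e hε3))))).exists
  obtain ⟨γ, ⟨L, hL⟩, hγU, hγ0, hγ1, hγA, hγE⟩ := (h1.trans hF hi).trans hF h2.symm
  refine (hle γ ⟨⟨L, hL.lipschitzOnWith⟩, hγU, hγ0, hγ1, hγA.trans (by ring)⟩).trans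
    (hγE.trans ?_)
  linarith

theorem exists_tendsto_of_eventually_mem_Icc (𝒰 : Ultrafilter ι) {u : ι → ℝ}
    (h : ∀ᶠ i in 𝒰, u i ∈ Icc a b) : ∃ x ∈ Icc a b, Tendsto u 𝒰 (𝓝 x) := by
  obtain ⟨x, hx, hl⟩ := isCompact_Icc.ultrafilter_le_nhds (𝒰.map u) (le_principal_iff.2 h)
  exact ⟨x, hx, hl⟩

theorem ReachIn.abs_area_le_of_near_well (hF : Continuous F) (hc : 0 < c)
    (hlow : ∀ x ∈ Metric.closedBall w R, c * ‖x - w‖ ≤ F x)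
    (h : ReachIn F (Metric.closedBall w R) p q A e) :
    |A| ≤ c⁻¹ * e + |w 1| * (2 * R) := by
  have hsub : Metric.closedBall w R ⊆ {x | |x 1 - w 1| ≤ c⁻¹ * F x} := fun x hx => by
    have h1 : |x 1 - w 1| ≤ ‖x - w‖ := PiLp.norm_apply_le (x - w) 1
    have h2 := hlow x hx
    rw [mem_ofPred_eq, inv_mul_eq_div, le_div_iff₀ hc]
    nlinarith
  refine ((h.mono hsub le_rfl).abs_area_le hF (inv_nonneg.2 hc.le)).trans ?_
  gcongr
  have h1 : |q 0 - p 0| ≤ ‖q - p‖ := PiLp.norm_apply_le (q - p) 0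
  have h2 := dist_triangle_right q p w
  rw [dist_eq_norm] at h2
  have h3 := Metric.mem_closedBall.1 h.left_mem
  have h4 := Metric.mem_closedBall.1 h.right_mem
  linarith

/-- Limits of curves near a well are attained. -/
theorem reachIn_univ_of_tendsto_near_well (𝒰 : Ultrafilter ι) (hF : Continuous F)
    (hF0 : ∀ x, 0 ≤ F x) {R' : ℝ} (hsol : OneWellSolvable F (Metric.ball w R') w) (hR0 : 0 < R)
    (hR : R < R') (hc : 0 < c) (hlow : ∀ x ∈ Metric.closedBall w R, c * ‖x - w‖ ≤ F x)
    (hne : p ≠ w ∨ q ≠ w) {Q : ι → Plane} {α E : ι → ℝ}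
    (h : ∀ᶠ i in 𝒰, ReachIn F (Metric.closedBall w R) p (Q i) (α i) (E i))
    (hQ : Tendsto Q 𝒰 (𝓝 q)) (hα : Tendsto α 𝒰 (𝓝 A)) (hE : Tendsto E 𝒰 (𝓝 e)) :
    ReachIn F univ p q A e := by
  have hsub : Metric.closedBall w R ⊆ Metric.ball w R' := Metric.closedBall_subset_ball hR
  have hwB : w ∈ Metric.ball w R' := Metric.mem_ball_self (hR0.trans hR)
  have hpB : p ∈ Metric.ball w R' := hsub h.exists.choose_spec.left_mem
  have hqB : q ∈ Metric.ball w R' := hsub (Metric.isClosed_closedBall.mem_of_tendsto hQ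
    (h.mono fun i hi => hi.right_mem))
  obtain ⟨L, hL⟩ := hsol
  have hmin : ∀ x ∈ Metric.ball w R', x ≠ w → ∀ A, ∃ σ,
      IsMinimizer F (oneWellClass (Metric.ball w R') x w A) σ := fun x hx hxw A =>
    (hL x ⟨hx, hxw⟩ A).imp fun _ h => h.1
  have hB : ∀ᶠ i in 𝒰, ReachIn F (Metric.ball w R') p (Q i) (α i) (E i) :=
    h.mono fun i hi => hi.mono hsub le_rfl
  by_cases hp : p = w
  · subst hp
    have := reachIn_well_of_tendsto (A := -A) hF hF0 Metric.isOpen_ball hqB hwB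
      (hmin q hqB (hne.resolve_left fun h => h rfl) _) (hB.mono fun i hi => hi.symm) hQ
      tendsto_const_nhds hα.neg hE
    simpa using this.symm
  by_cases hq : q = w
  · subst hq
    exact reachIn_well_of_tendsto hF hF0 Metric.isOpen_ball hpB hwB (hmin p hpB hp _) hB
      tendsto_const_nhds hQ hα hE
  have hcut : ∀ i, ∃ z A₁ e₁, ReachIn F (Metric.closedBall w R) p (Q i) (α i) (E i) →
      z ∈ Metric.closedBall w R ∧
      ReachIn F (Metric.closedBall w R ∩ {x | ‖z - w‖ ≤ ‖x - w‖}) p (Q i) (α i) (E i) ∧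
      ReachIn F (Metric.closedBall w R) p z A₁ e₁ ∧
      ReachIn F (Metric.closedBall w R) z (Q i) (α i - A₁) (E i - e₁) := fun i => by
    by_cases hi : ReachIn F (Metric.closedBall w R) p (Q i) (α i) (E i)
    · obtain ⟨z, hz, A₁, e₁, hh⟩ := hi.nearest hF w
      exact ⟨z, A₁, e₁, fun _ => ⟨hz, hh⟩⟩
    · exact ⟨p, 0, 0, fun h => absurd h hi⟩
  choose z A₁ e₁ hprop using hcut
  have hev := h.mono fun i hi => hprop i hi
  obtain ⟨d, hd, hlim⟩ := exists_tendsto_of_eventually_mem_Icc 𝒰 (u := fun i => ‖z i - w‖)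
    (a := 0) (b := R) (hev.mono fun i hi => ⟨norm_nonneg _, mem_closedBall_iff_norm.1 hi.1⟩)
  rcases hd.1.eq_or_lt with rfl | hd0
  · have hz : Tendsto z 𝒰 (𝓝 w) := tendsto_iff_norm_sub_tendsto_zero.2 hlim
    have hE1 : ∀ᶠ i in 𝒰, E i ≤ e + 1 := hE.eventually_le_const (lt_add_one e)
    have he₁ : ∀ᶠ i in 𝒰, e₁ i ∈ Icc 0 (e + 1) := by
      filter_upwards [hev, hE1] with i hi hi1
      have h1 := hi.2.2.1.nonneg hF0
      have h2 := hi.2.2.2.nonneg hF0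
      exact ⟨h1, by linarith⟩
    obtain ⟨ε₁, -, hε₁⟩ := exists_tendsto_of_eventually_mem_Icc 𝒰 he₁
    obtain ⟨a₁, -, ha₁⟩ := exists_tendsto_of_eventually_mem_Icc 𝒰 (u := A₁)
      (a := -(c⁻¹ * (e + 1) + |w 1| * (2 * R))) (b := c⁻¹ * (e + 1) + |w 1| * (2 * R)) (by
        filter_upwards [hev, he₁] with i hi hi1
        refine abs_le.1 ((hi.2.2.1.abs_area_le_of_near_well hF hc hlow).trans ?_)
        gcongr
        exact hi1.2)
    have r1 := reachIn_well_of_tendsto hF hF0 Metric.isOpen_ball hpB hwB (hmin p hpB hp a₁)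
      (hev.mono fun i hi => hi.2.2.1.mono hsub le_rfl) tendsto_const_nhds hz ha₁ hε₁
    have r2 := reachIn_well_of_tendsto hF hF0 Metric.isOpen_ball hqB hwB
      (hmin q hqB hq (-(A - a₁))) (hev.mono fun i hi => (hi.2.2.2.mono hsub le_rfl).symm)
      hQ hz (hα.sub ha₁).neg (hE.sub hε₁)
    have := r1.trans hF r2.symm
    simpa using this
  · have hhalf : ∀ᶠ i in 𝒰, d / 2 ≤ ‖z i - w‖ :=
      hlim.eventually_const_le (half_lt_self hd0)
    refine reachIn_univ_of_tendsto 𝒰 hF hF0 (c := c * (d / 2)) (by positivity) ?_ hQ hα hE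
    filter_upwards [hev, hhalf] with i hi hi1
    refine hi.2.1.mono (fun x hx => ?_) le_rfl
    refine le_trans ?_ (hlow x hx.1)
    have : ‖z i - w‖ ≤ ‖x - w‖ := hx.2
    gcongr
    linarith

/-- The set of almost attained data is closed. -/
theorem reachIn_add_of_tendsto {l : Filter ι} [l.NeBot] (hF : Continuous F)
    (hF0 : ∀ x, 0 ≤ F x) {Z : ι → Plane} {α E : ι → ℝ}
    (h : ∀ᶠ i in l, ReachIn F univ (Z i) q (α i) (E i)) (hZ : Tendsto Z l (𝓝 z))
    (hα : Tendsto α l (𝓝 A)) (hE : Tendsto E l (𝓝 e)) (hε : 0 < ε) :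
    ReachIn F univ z q A (e + ε) := by
  have hα0 : Tendsto (fun i => A - α i) l (𝓝 0) := by simpa using hα.const_sub A
  have c1 : ∀ᶠ i in l, ReachIn F univ z (Z i) (A - α i) (ε / 2) :=
    (hZ.prodMk_nhds hα0).eventually (eventually_reachIn hF hF0 univ_mem (half_pos hε))
  obtain ⟨i, hi, h1, h2⟩ := (h.and (c1.and
    (hE.eventually_le_const (lt_add_of_pos_right e (half_pos hε))))).exists
  have := (h1.trans hF hi).mono subset_rfl (show ε / 2 + E i ≤ e + ε by linarith)
  simpa using this

/-! ### Linear growth of the conformal factor at a well -/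

theorem exists_pos_mul_sq_le_of_pos (H : Plane →L[ℝ] Plane →L[ℝ] ℝ)
    (hH : ∀ v, v ≠ 0 → 0 < H v v) : ∃ m > 0, ∀ v, m * ‖v‖ ^ 2 ≤ H v v := by
  have hcont : Continuous fun v : Plane => H v v := by fun_prop
  obtain ⟨v₀, hv₀, hmin⟩ := (isCompact_sphere (0 : Plane) 1).exists_isMinOn
    (NormedSpace.sphere_nonempty.2 zero_le_one) hcont.continuousOn
  refine ⟨H v₀ v₀, hH v₀ (ne_zero_of_mem_unit_sphere ⟨v₀, hv₀⟩), fun v => ?_⟩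
  rcases eq_or_ne v 0 with rfl | hv
  · simp
  have hn : ‖v‖ ≠ 0 := norm_ne_zero_iff.2 hv
  have h1 : H v₀ v₀ ≤ H (‖v‖⁻¹ • v) (‖v‖⁻¹ • v) := hmin (by simp [norm_smul, hn])
  simp only [map_smul, smul_apply, smul_eq_mul] at h1
  have := mul_le_mul_of_nonneg_right h1 (sq_nonneg ‖v‖)
  refine this.trans_eq ?_
  field_simp

theorem exists_quadratic_lower_bound (hW : ContDiffAt ℝ 2 W w) (hmin : IsLocalMin W w)
    (hW0 : W w = 0) (hH : HessianPosDef W w) :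
    ∃ m > 0, ∀ᶠ x in 𝓝 w, m * ‖x - w‖ ^ 2 ≤ W x := by
  obtain ⟨m, hm, hmH⟩ := exists_pos_mul_sq_le_of_pos _ hH
  have hD : DifferentiableAt ℝ (fderiv ℝ W) w :=
    (hW.fderiv_right (m := 1) (by norm_num)).differentiableAt (by norm_num)
  have ho := hD.hasFDerivAt.isLittleO.def (half_pos hm)
  have hdiff : ∀ᶠ x in 𝓝 w, DifferentiableAt ℝ W x :=
    (hW.eventually (by simp)).mono fun x hx => hx.differentiableAt (by norm_num)
  obtain ⟨ρ, hρ, hball⟩ := Metric.eventually_nhds_iff_ball.1 (ho.and hdiff)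
  refine ⟨m / 4, by positivity, Metric.eventually_nhds_iff_ball.2 ⟨ρ, hρ, fun x hx => ?_⟩⟩
  set v := x - w with hv
  have hseg : ∀ t ∈ Icc (0 : ℝ) 1, w + t • v ∈ Metric.ball w ρ := fun t ht => by
    rw [mem_ball_iff_norm, add_sub_cancel_left, norm_smul, Real.norm_of_nonneg ht.1]
    exact (mul_le_of_le_one_left (norm_nonneg _) ht.2).trans_lt (mem_ball_iff_norm.1 hx)
  have hder : ∀ t ∈ Icc (0 : ℝ) 1, HasDerivAt
      (fun t : ℝ => W (w + t • v) - m / 4 * ‖v‖ ^ 2 * t ^ 2)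
      (fderiv ℝ W (w + t • v) v - m / 4 * ‖v‖ ^ 2 * (2 * t)) t := fun t ht => by
    have h1 : HasDerivAt (fun t : ℝ => w + t • v) v t := by
      simpa using ((hasDerivAt_id t).smul_const v).const_add w
    have h2 := (hball _ (hseg t ht)).2.hasFDerivAt.comp_hasDerivAt t h1
    have h3 := (hasDerivAt_pow 2 t).const_mul (m / 4 * ‖v‖ ^ 2)
    exact (h2.sub h3).congr_deriv (by norm_num)
  have hmono : MonotoneOn (fun t : ℝ => W (w + t • v) - m / 4 * ‖v‖ ^ 2 * t ^ 2) (Icc 0 1) := by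
    refine monotoneOn_of_deriv_nonneg (convex_Icc 0 1)
      (fun t ht => (hder t ht).continuousAt.continuousWithinAt)
      (fun t ht => (hder t (interior_subset ht)).differentiableAt.differentiableWithinAt)
      fun t ht => ?_
    have ht' := interior_subset ht
    rw [(hder t ht').deriv]
    have h1 := (hball _ (hseg t ht')).1
    rw [hmin.fderiv_eq_zero, add_sub_cancel_left, sub_zero, map_smul, norm_smul,
      Real.norm_of_nonneg ht'.1] at h1
    have h2 := (ContinuousLinearMap.le_opNorm
      (fderiv ℝ W (w + t • v) - t • fderiv ℝ (fderiv ℝ W) w v) v).trans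
      (mul_le_mul_of_nonneg_right h1 (norm_nonneg v))
    rw [sub_apply, smul_apply, smul_eq_mul] at h2
    have h3 := (abs_le.1 h2).1
    have h4 := mul_le_mul_of_nonneg_left (hmH v) ht'.1
    nlinarith
  have h01 := hmono ⟨le_rfl, zero_le_one⟩ ⟨zero_le_one, le_rfl⟩ zero_le_one
  simp only [zero_smul, one_smul, add_zero, hW0, hv, add_sub_cancel] at h01
  norm_num at h01
  linarith

/-- At a nondegenerate well the conformal factor grows at least linearly. -/
theorem exists_linear_lower_bound {R' : ℝ} (hF : Continuous F) (hF0 : ∀ p, 0 ≤ F p)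
    (hWF : ∀ p, W p = F p ^ 2) (hR0 : 0 < R) (hR : R < R')
    (hsmooth : ContDiffOn ℝ ∞ W (Metric.ball w R')) (hH : HessianPosDef W w) (hw : F w = 0)
    (hpos : ∀ x ∈ Metric.closedBall w R, x ≠ w → 0 < F x) :
    ∃ c > 0, ∀ x ∈ Metric.closedBall w R, c * ‖x - w‖ ≤ F x := by
  have hW0 : W w = 0 := by rw [hWF, hw]; norm_num
  have hC : ContDiffAt ℝ 2 W w := contDiffAt_infty.1 (hsmooth.contDiffAt
    (Metric.ball_mem_nhds w (hR0.trans hR))) 2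
  obtain ⟨m, hm, hev⟩ := exists_quadratic_lower_bound hC
    (Eventually.of_forall fun x => by rw [hW0, hWF]; positivity) hW0 hH
  obtain ⟨ρ, hρ, hball⟩ := Metric.eventually_nhds_iff_ball.1 hev
  have hnear : ∀ x ∈ Metric.ball w ρ, √m * ‖x - w‖ ≤ F x := fun x hx => by
    refine abs_le_of_sq_le_sq' ?_ (hF0 x) |>.2
    rw [mul_pow, Real.sq_sqrt hm.le, ← hWF]
    exact hball x hx
  have hcomp : IsCompact (Metric.closedBall w R \ Metric.ball w ρ) :=
    (isCompact_closedBall w R).diff Metric.isOpen_ball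
  have hfar : ∃ μ > 0, ∀ x ∈ Metric.closedBall w R \ Metric.ball w ρ, μ ≤ F x := by
    rcases (Metric.closedBall w R \ Metric.ball w ρ).eq_empty_or_nonempty with h | h
    · exact ⟨1, one_pos, by simp [h]⟩
    · obtain ⟨x₀, hx₀, hmin⟩ := hcomp.exists_isMinOn h hF.continuousOn
      exact ⟨F x₀, hpos x₀ hx₀.1 fun h0 => hx₀.2 (h0 ▸ Metric.mem_ball_self hρ), hmin⟩
  obtain ⟨μ, hμ, hfar⟩ := hfar
  refine ⟨min (√m) (μ / R), lt_min (Real.sqrt_pos.2 hm) (by positivity), fun x hx => ?_⟩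
  by_cases hxρ : x ∈ Metric.ball w ρ
  · exact (mul_le_mul_of_nonneg_right (min_le_left _ _) (norm_nonneg _)).trans (hnear x hxρ)
  · refine le_trans ?_ (hfar x ⟨hx, hxρ⟩)
    calc min (√m) (μ / R) * ‖x - w‖ ≤ μ / R * R :=
          mul_le_mul (min_le_right _ _) (mem_closedBall_iff_norm.1 hx) (norm_nonneg _)
            (by positivity)
      _ = μ := by field_simp

end

section

variable {F W : Plane → ℝ} {U V S : Set Plane} {p q w z : Plane} {c m r A C e M R ε η : ℝ}

/-! ### Limits of cut curves -/

/-- `q` may be reached from `p` with area `A` and energy arbitrarily close to `e`. -/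
def AlmostReach (F : Plane → ℝ) (p q : Plane) (A e : ℝ) : Prop :=
  ∀ ε > 0, ReachIn F univ p q A (e + ε)

theorem AlmostReach.nonneg (hF0 : ∀ x, 0 ≤ F x) (h : AlmostReach F p q A e) : 0 ≤ e :=
  le_of_forall_pos_le_add fun ε hε => (h ε hε).nonneg hF0

theorem exists_limit_cut (𝒰 : Ultrafilter ℕ) (hF : Continuous F) (hF0 : ∀ x, 0 ≤ F x)
    (hS : IsCompact S) {E : ℕ → ℝ} (hE : Tendsto E 𝒰 (𝓝 e))
    (harea : ∀ z ∈ S, ∀ A₁ e₁, e₁ ≤ e + 1 → ReachIn F V p z A₁ e₁ → |A₁| ≤ M)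
    (hlow : ∀ z ∈ S, ∀ A₁ e₁, ReachIn F V p z A₁ e₁ → η ≤ e₁)
    (hlim : ∀ z ∈ S, ∀ (Q : ℕ → Plane) (α ε : ℕ → ℝ) (a₁ ε₁ : ℝ),
      (∀ᶠ i in 𝒰, ReachIn F V p (Q i) (α i) (ε i)) → Tendsto Q 𝒰 (𝓝 z) → Tendsto α 𝒰 (𝓝 a₁) →
      Tendsto ε 𝒰 (𝓝 ε₁) → ReachIn F univ p z a₁ ε₁)
    (h : ∀ᶠ i in 𝒰, ∃ z ∈ S, ∃ A₁ e₁, ReachIn F V p z A₁ e₁ ∧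
      ReachIn F univ z q (A - A₁) (E i - e₁)) :
    ∃ z ∈ S, ∃ A₁ e₁, η ≤ e₁ ∧ ReachIn F univ p z A₁ e₁ ∧ AlmostReach F z q (A - A₁) (e - e₁) := by
  have hcut : ∀ i, ∃ z A₁ e₁, (∃ z ∈ S, ∃ A₁ e₁, ReachIn F V p z A₁ e₁ ∧
      ReachIn F univ z q (A - A₁) (E i - e₁)) → z ∈ S ∧ ReachIn F V p z A₁ e₁ ∧
      ReachIn F univ z q (A - A₁) (E i - e₁) := fun i => by
    by_cases hi : ∃ z ∈ S, ∃ A₁ e₁, ReachIn F V p z A₁ e₁ ∧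
      ReachIn F univ z q (A - A₁) (E i - e₁)
    · obtain ⟨z, hz, A₁, e₁, hh⟩ := hi
      exact ⟨z, A₁, e₁, fun _ => ⟨hz, hh⟩⟩
    · exact ⟨p, 0, 0, fun h => absurd h hi⟩
  choose z A₁ e₁ hprop using hcut
  have hev := h.mono fun i hi => hprop i hi
  obtain ⟨z₀, hz₀, hz⟩ := hS.ultrafilter_le_nhds (𝒰.map z)
    (le_principal_iff.2 (hev.mono fun i hi => hi.1))
  have he₁ : ∀ᶠ i in 𝒰, e₁ i ∈ Icc 0 (e + 1) := by
    filter_upwards [hev, hE.eventually_le_const (lt_add_one e)] with i hi hi1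
    have h1 := hi.2.1.nonneg hF0
    have h2 := hi.2.2.nonneg hF0
    exact ⟨h1, by linarith⟩
  obtain ⟨ε₁, -, hε₁⟩ := exists_tendsto_of_eventually_mem_Icc 𝒰 he₁
  obtain ⟨a₁, -, ha₁⟩ := exists_tendsto_of_eventually_mem_Icc 𝒰 (u := A₁) (a := -M) (b := M) (by
    filter_upwards [hev, he₁] with i hi hi1
    exact abs_le.1 (harea _ hi.1 _ _ hi1.2 hi.2.1))
  refine ⟨z₀, hz₀, a₁, ε₁, ge_of_tendsto hε₁ (hev.mono fun i hi => hlow _ hi.1 _ _ hi.2.1),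
    hlim z₀ hz₀ z A₁ e₁ a₁ ε₁ (hev.mono fun i hi => hi.2.1) hz ha₁ hε₁, fun ε hε => ?_⟩
  exact reachIn_add_of_tendsto hF hF0 (hev.mono fun i hi => hi.2.2) hz (ha₁.const_sub A)
    (hE.sub hε₁) hε

theorem tendsto_add_one_div_hyperfilter (e : ℝ) :
    Tendsto (fun n : ℕ => e + 1 / ((n : ℝ) + 1)) (hyperfilter ℕ : Filter ℕ) (𝓝 e) := by
  have := (tendsto_one_div_add_atTop_nhds_zero_nat (𝕜 := ℝ)).const_add e
  rw [add_zero] at this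
  exact this.mono_left Nat.hyperfilter_le_atTop

theorem AlmostReach.reachIn_or_exists_cut_near_well (hF : Continuous F) (hF0 : ∀ x, 0 ≤ F x)
    {R' : ℝ} (hsol : OneWellSolvable F (Metric.ball w R') w) (hr : 0 < r) (hrR : r < R)
    (hR : R < R') (hc : 0 < c) (hlow : ∀ x ∈ Metric.closedBall w R, c * ‖x - w‖ ≤ F x)
    (hp : ‖p - w‖ ≤ r) (hpq : p ≠ q) (h : AlmostReach F p q A e) :
    ReachIn F univ p q A e ∨ ∃ z ∈ Metric.sphere w R, ∃ A₁ e₁, c * (R ^ 2 - r ^ 2) / 2 ≤ e₁ ∧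
      ReachIn F univ p z A₁ e₁ ∧ AlmostReach F z q (A - A₁) (e - e₁) := by
  have hR0 : 0 < R := hr.trans hrR
  have hE := tendsto_add_one_div_hyperfilter e
  have hT : IsClosed (Metric.ball w R)ᶜ := Metric.isOpen_ball.isClosed_compl
  have hpT : p ∉ (Metric.ball w R)ᶜ := fun h => h (mem_ball_iff_norm.2 (hp.trans_lt hrR))
  have hcl : closure (Metric.ball w R)ᶜᶜ ⊆ Metric.closedBall w R := by
    rw [compl_compl]
    exact Metric.closure_ball_subset_closedBall
  have hall : ∀ᶠ n : ℕ in hyperfilter ℕ, _ := Eventually.of_forall fun n : ℕ =>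
    (h (1 / ((n : ℝ) + 1)) (by positivity)).first_hit hF hT hpT
  rcases Ultrafilter.eventually_or.1 hall with h1 | h1
  · left
    refine reachIn_univ_of_tendsto_near_well (hyperfilter ℕ) hF hF0 hsol hR0 hR hc hlow ?_
      (h1.mono fun n hn => hn.mono (subset_closure.trans hcl) le_rfl) tendsto_const_nhds
      tendsto_const_nhds hE
    by_contra! hcon
    exact hpq (hcon.1.trans hcon.2.symm)
  · right
    refine exists_limit_cut (hyperfilter ℕ) hF hF0 (V := Metric.closedBall w R)
      (M := c⁻¹ * (e + 1) + |w 1| * (2 * R)) (isCompact_sphere w R) hE ?_ ?_ ?_ ?_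
    · intro z _ A₁ e₁ he₁ hz
      refine (hz.abs_area_le_of_near_well hF hc hlow).trans ?_
      gcongr
    · intro z hz A₁ e₁ h
      refine le_trans ?_ ((h.mono hlow le_rfl).mul_sq_sub_sq_le hF hc.le)
      rw [mem_sphere_iff_norm.1 hz]
      gcongr
    · intro z hz Q α ε a₁ ε₁ h hQ hα hε
      refine reachIn_univ_of_tendsto_near_well (hyperfilter ℕ) hF hF0 hsol hR0 hR hc hlow
        (Or.inr fun h => ?_) h hQ hα hε
      exact Metric.ne_of_mem_sphere hz hR0.ne' h
    · refine h1.mono fun n hn => ?_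
      obtain ⟨z, hz, A₁, e₁, hz1, hz2⟩ := hn
      refine ⟨z, ?_, A₁, e₁, hz1.mono hcl le_rfl, hz2⟩
      have h1 := hcl hz.2
      have h2 : ¬ dist z w < R := hz.1
      exact le_antisymm h1 (not_lt.1 h2)

theorem ReachIn.inter_closedBall (hF : Continuous F) (hm : 0 < m)
    (h : ReachIn F {x | m ≤ F x} p q A e) :
    ReachIn F ({x | m ≤ F x} ∩ Metric.closedBall p (e / m)) p q A e := by
  obtain ⟨γ, ⟨K, hK⟩, hU, rfl, rfl, rfl, hE⟩ := h
  refine ⟨γ, ⟨K, hK⟩, fun t ht => ⟨hU ht, ?_⟩, rfl, rfl, rfl, hE⟩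
  rw [mem_closedBall_iff_norm, le_div_iff₀' hm]
  refine le_trans ?_ ((mul_arclength_le_energy hF hK hU).trans hE)
  have h1 := norm_sub_le_integral_norm_deriv hK ht.1
  have h2 := norm_sub_le_integral_norm_deriv hK ht.2
  have h3 := intervalIntegral.integral_add_adjacent_intervals
    (intervalIntegrable_norm_deriv hK 0 t) (intervalIntegrable_norm_deriv hK t 1)
  rw [arclength]
  gcongr
  linarith [norm_nonneg (γ 1 - γ t)]

theorem ReachIn.abs_area_le_of_le (hF : Continuous F) (hF0 : ∀ x, 0 ≤ F x) (hm : 0 < m)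
    (h : ReachIn F {x | m ≤ F x} p q A e) :
    |A| ≤ e / m / m * e + |p 1| * (e / m) := by
  have he := h.nonneg hF0
  have h' := h.inter_closedBall hF hm
  have hsub : {x | m ≤ F x} ∩ Metric.closedBall p (e / m) ⊆
      {x | |x 1 - p 1| ≤ e / m / m * F x} := fun x hx => by
    have h1 : |x 1 - p 1| ≤ ‖x - p‖ := PiLp.norm_apply_le (x - p) 1
    have h2 := mem_closedBall_iff_norm.1 hx.2
    have h3 : m ≤ F x := hx.1
    calc |x 1 - p 1| ≤ e / m / m * m := by rw [div_mul_cancel₀ _ hm.ne']; exact h1.trans h2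
      _ ≤ e / m / m * F x := by gcongr
  refine ((h'.mono hsub le_rfl).abs_area_le hF (by positivity)).trans ?_
  gcongr
  have h1 : |q 0 - p 0| ≤ ‖q - p‖ := PiLp.norm_apply_le (q - p) 0
  exact h1.trans (mem_closedBall_iff_norm.1 h'.right_mem.2)

theorem AlmostReach.exists_cut_far (hF : Continuous F) (hF0 : ∀ x, 0 ≤ F x) (hm : 0 < m)
    (hrR : r < R) {T : Set Plane} (hT : IsCompact T) (hTm : ∀ x ∈ closure Tᶜ, m ≤ F x)
    (hpT : ∀ x ∈ T, R - r ≤ ‖x - p‖) (hqT : q ∈ T) (h : AlmostReach F p q A e) :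
    ∃ z ∈ T ∩ closure Tᶜ, ∃ A₁ e₁, m * (R - r) ≤ e₁ ∧
      ReachIn F univ p z A₁ e₁ ∧ AlmostReach F z q (A - A₁) (e - e₁) := by
  have hE := tendsto_add_one_div_hyperfilter e
  have hp : p ∉ T := fun hp => by
    have := hpT p hp
    rw [sub_self, norm_zero] at this
    linarith
  have he := h.nonneg hF0
  refine exists_limit_cut (hyperfilter ℕ) hF hF0 (V := {x | m ≤ F x})
    (M := (e + 1) / m / m * (e + 1) + |p 1| * ((e + 1) / m))
    (hT.inter_right isClosed_closure) hE ?_ ?_ ?_ ?_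
  · intro z _ A₁ e₁ he₁ hz
    have := hz.nonneg hF0
    refine (hz.abs_area_le_of_le hF hF0 hm).trans ?_
    gcongr
  · intro z hz A₁ e₁ h
    refine le_trans ?_ (h.mul_norm_sub_le hF hm.le)
    have := hpT z hz.1
    gcongr
  · intro z hz Q α ε a₁ ε₁ h hQ hα hε
    exact reachIn_univ_of_tendsto (hyperfilter ℕ) hF hF0 hm h hQ hα hε
  · refine Eventually.of_forall fun n : ℕ => ?_
    rcases (h (1 / ((n : ℝ) + 1)) (by positivity)).first_hit hF hT.isClosed hp with h1 | h1
    · exact absurd hqT h1.right_mem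
    · obtain ⟨z, hz, A₁, e₁, hz1, hz2⟩ := h1
      exact ⟨z, hz, A₁, e₁, hz1.mono hTm le_rfl, hz2⟩

/-! ### Existence of minimizers for the two-well problem -/

/-- The infimum of the energy between the wells is attained. -/
theorem AlmostReach.reachIn {pp pm : Plane} {Rp Rm : ℝ} (hF : Continuous F)
    (hF0 : ∀ x, 0 ≤ F x) (hne : pp ≠ pm)
    (hdisj : Disjoint (Metric.ball pp Rp) (Metric.ball pm Rm))
    (hsolp : OneWellSolvable F (Metric.ball pp Rp) pp)
    (hsolm : OneWellSolvable F (Metric.ball pm Rm) pm)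
    (hr : 0 < r) (hrR : r < R) (hRp : R < Rp) (hRm : R < Rm) (hc : 0 < c)
    (hlowp : ∀ x ∈ Metric.closedBall pp R, c * ‖x - pp‖ ≤ F x)
    (hlowm : ∀ x ∈ Metric.closedBall pm R, c * ‖x - pm‖ ≤ F x) (hm : 0 < m)
    (hfar : ∀ x, r ≤ ‖x - pp‖ → r ≤ ‖x - pm‖ → m ≤ F x)
    (h : AlmostReach F pm pp A e) : ReachIn F univ pm pp A e := by
  have hR0 : 0 < R := hr.trans hrR
  set η := min (m * (R - r)) (c * (R ^ 2 - r ^ 2) / 2) with hη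
  have hη0 : 0 < η := by
    refine lt_min (mul_pos hm (by linarith)) ?_
    have : 0 < R ^ 2 - r ^ 2 := by nlinarith
    positivity
  have hfarp : ∀ x ∈ Metric.closedBall pp R, R ≤ ‖x - pm‖ := fun x hx => by
    by_contra hcon
    exact hdisj.le_bot ⟨Metric.closedBall_subset_ball hRp hx,
      mem_ball_iff_norm.2 ((not_le.1 hcon).trans hRm)⟩
  have hfarm : ∀ x ∈ Metric.closedBall pm R, R ≤ ‖x - pp‖ := fun x hx => by
    by_contra hcon
    exact hdisj.le_bot ⟨mem_ball_iff_norm.2 ((not_le.1 hcon).trans hRp),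
      Metric.closedBall_subset_ball hRm hx⟩
  have main : ∀ k : ℕ, ∀ p : Plane, (p ≠ pp ∧ (‖p - pp‖ ≤ r ∨ ‖p - pm‖ ≤ r) ∨
      R ≤ ‖p - pp‖ ∧ R ≤ ‖p - pm‖) → ∀ A e : ℝ, e < k * η → AlmostReach F p pp A e →
      ReachIn F univ p pp A e := by
    intro k
    induction k with
    | zero =>
      intro p _ A e he h
      have := h.nonneg hF0
      simp only [Nat.cast_zero, zero_mul] at he
      linarith
    | succ k ih =>
      intro p hp A e he h
      rw [Nat.cast_succ, add_one_mul] at he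
      have finish : ∀ z A₁ e₁, (z ≠ pp ∧ (‖z - pp‖ ≤ r ∨ ‖z - pm‖ ≤ r) ∨
          R ≤ ‖z - pp‖ ∧ R ≤ ‖z - pm‖) → η ≤ e₁ → ReachIn F univ p z A₁ e₁ →
          AlmostReach F z pp (A - A₁) (e - e₁) → ReachIn F univ p pp A e := by
        intro z A₁ e₁ hz he₁ h1 h2
        have := h1.trans hF (ih z hz _ _ (by linarith) h2)
        simpa using this
      rcases hp with ⟨hpp, hp | hp⟩ | ⟨hp1, hp2⟩
      · rcases h.reachIn_or_exists_cut_near_well hF hF0 hsolp hr hrR hRp hc hlowp hp hpp with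
          h1 | ⟨z, hz, A₁, e₁, he₁, h1, h2⟩
        · exact h1
        · exact finish z A₁ e₁ (Or.inr ⟨(mem_sphere_iff_norm.1 hz).ge,
            hfarp z (Metric.sphere_subset_closedBall hz)⟩) ((min_le_right _ _).trans he₁) h1 h2
      · rcases h.reachIn_or_exists_cut_near_well hF hF0 hsolm hr hrR hRm hc hlowm hp hpp with
          h1 | ⟨z, hz, A₁, e₁, he₁, h1, h2⟩
        · exact h1
        · exact finish z A₁ e₁ (Or.inr ⟨hfarm z (Metric.sphere_subset_closedBall hz),
            (mem_sphere_iff_norm.1 hz).ge⟩) ((min_le_right _ _).trans he₁) h1 h2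
      · have hcl : closure (Metric.closedBall pp r ∪ Metric.closedBall pm r)ᶜ ⊆
            {x | r ≤ ‖x - pp‖ ∧ r ≤ ‖x - pm‖} := by
          have hcont : ∀ w : Plane, Continuous fun x : Plane => ‖x - w‖ := fun w => by fun_prop
          refine closure_minimal (fun x hx => ?_) ((isClosed_le continuous_const
            (hcont pp)).and (isClosed_le continuous_const (hcont pm)))
          rw [mem_compl_iff, mem_union, not_or, mem_closedBall_iff_norm,
            mem_closedBall_iff_norm] at hx
          exact ⟨(not_le.1 hx.1).le, (not_le.1 hx.2).le⟩
        have hdist : ∀ x ∈ Metric.closedBall pp r ∪ Metric.closedBall pm r, R - r ≤ ‖x - p‖ := by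
          rintro x (hx | hx)
          · have h3 := norm_sub_le_norm_sub_add_norm_sub p x pp
            rw [norm_sub_rev p x] at h3
            linarith [mem_closedBall_iff_norm.1 hx]
          · have h3 := norm_sub_le_norm_sub_add_norm_sub p x pm
            rw [norm_sub_rev p x] at h3
            linarith [mem_closedBall_iff_norm.1 hx]
        obtain ⟨z, hz, A₁, e₁, he₁, h1, h2⟩ := h.exists_cut_far hF hF0 hm hrR
          ((isCompact_closedBall pp r).union (isCompact_closedBall pm r))
          (fun x hx => hfar x (hcl hx).1 (hcl hx).2) hdist
          (Or.inl (Metric.mem_closedBall_self hr.le))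
        refine finish z A₁ e₁ (Or.inl ⟨fun h0 => ?_, hz.1.imp mem_closedBall_iff_norm.1
          mem_closedBall_iff_norm.1⟩) ((min_le_left _ _).trans he₁) h1 h2
        have := (hcl hz.2).1
        rw [h0, sub_self, norm_zero] at this
        linarith
  obtain ⟨k, hk⟩ := exists_nat_gt (e / η)
  exact main k pm (Or.inl ⟨hne.symm, Or.inr (by simpa using hr.le)⟩) A e
    ((div_lt_iff₀ hη0).1 hk) h

theorem exists_pos_le_of_far {pp pm : Plane} {Rp Rm m₀ : ℝ} (hF : Continuous F)
    (hpos : ∀ x, x ≠ pp → x ≠ pm → 0 < F x) (hm₀ : 0 < m₀)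
    (hlb : ∀ p, p ∉ Metric.ball pp Rp ∪ Metric.ball pm Rm → m₀ ≤ F p) (hr : 0 < r) :
    ∃ m > 0, ∀ x, r ≤ ‖x - pp‖ → r ≤ ‖x - pm‖ → m ≤ F x := by
  set T := (Metric.closedBall pp Rp ∪ Metric.closedBall pm Rm) \
    (Metric.ball pp r ∪ Metric.ball pm r) with hT
  have hTc : IsCompact T := ((isCompact_closedBall pp Rp).union
    (isCompact_closedBall pm Rm)).diff (Metric.isOpen_ball.union Metric.isOpen_ball)
  have hTm : ∃ μ > 0, ∀ x ∈ T, μ ≤ F x := by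
    rcases T.eq_empty_or_nonempty with h | h
    · exact ⟨1, one_pos, by simp [h]⟩
    · obtain ⟨x₀, hx₀, hmin⟩ := hTc.exists_isMinOn h hF.continuousOn
      exact ⟨F x₀, hpos x₀ (fun h0 => hx₀.2 (Or.inl (h0 ▸ Metric.mem_ball_self hr)))
        (fun h0 => hx₀.2 (Or.inr (h0 ▸ Metric.mem_ball_self hr))), hmin⟩
  obtain ⟨μ, hμ, hTμ⟩ := hTm
  refine ⟨min m₀ μ, lt_min hm₀ hμ, fun x h1 h2 => ?_⟩
  by_cases hx : x ∈ Metric.ball pp Rp ∪ Metric.ball pm Rm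
  · refine (min_le_right _ _).trans (hTμ x ⟨hx.imp (fun h => Metric.ball_subset_closedBall h)
      fun h => Metric.ball_subset_closedBall h, ?_⟩)
    rintro (h | h)
    · exact (mem_ball_iff_norm.1 h).not_ge h1
    · exact (mem_ball_iff_norm.1 h).not_ge h2
  · exact (min_le_left _ _).trans (hlb x hx)

theorem reachIn_univ_of_mem_twoWellClass {γ : ℝ → Plane} (h : γ ∈ twoWellClass p q A) :
    ReachIn F univ p q A (energy F γ) := by
  obtain ⟨hl, rfl, rfl, rfl⟩ := h
  obtain ⟨K, hK⟩ := hl.exists_lipschitzOnWith_of_compact isCompact_Icc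
  exact reachIn_of_lipschitzOnWith hK (mapsTo_univ _ _)

theorem ReachIn.exists_mem_twoWellClass (h : ReachIn F U p q A e) :
    ∃ γ ∈ twoWellClass p q A, energy F γ ≤ e := by
  obtain ⟨γ, ⟨K, hK⟩, -, h0, h1, hA, hE⟩ := h
  exact ⟨γ, ⟨hK.locallyLipschitz.locallyLipschitzOn, h0, h1, hA⟩, hE⟩

theorem exists_isMinimizer_twoWellClass (hF : Continuous F) (hF0 : ∀ x, 0 ≤ F x)
    (h : ∀ e, AlmostReach F p q A e → ReachIn F univ p q A e) :
    ∃ γ, IsMinimizer F (twoWellClass p q A) γ := by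
  set s := {e | ReachIn F univ p q A e} with hs
  have hne : s.Nonempty := exists_reachIn_univ hF hF0 p q A
  have hbdd : BddBelow s := ⟨0, fun e he => he.nonneg hF0⟩
  have hinf : AlmostReach F p q A (sInf s) := fun ε hε => by
    obtain ⟨e, he, hlt⟩ := exists_lt_of_csInf_lt hne (lt_add_of_pos_right (sInf s) hε)
    exact he.mono subset_rfl hlt.le
  obtain ⟨γ, hγ, hE⟩ := (h _ hinf).exists_mem_twoWellClass
  exact ⟨γ, hγ, fun σ hσ => hE.trans (csInf_le hbdd (reachIn_univ_of_mem_twoWellClass hσ))⟩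

end

end Isoperimetric

end

theorem theorem3p1
    (F W : Isoperimetric.Plane → ℝ) (pp pm : Isoperimetric.Plane) (Rp Rm m₀ : ℝ)
    (hF : ∀ p, 0 ≤ F p)
    (hWF : ∀ p, W p = F p ^ 2)
    (hWcont : Continuous W)
    (hne : pp ≠ pm)
    (hzero : ∀ p, W p = 0 ↔ p = pp ∨ p = pm)
    (hRp : 0 < Rp) (hRm : 0 < Rm)
    (hdisj : Disjoint (Metric.ball pp Rp) (Metric.ball pm Rm))
    (hsmoothp : ContDiffOn ℝ ∞ W (Metric.ball pp Rp))
    (hsmoothm : ContDiffOn ℝ ∞ W (Metric.ball pm Rm))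
    (hhessp : Isoperimetric.HessianPosDef W pp)
    (hhessm : Isoperimetric.HessianPosDef W pm)
    (hAp : Isoperimetric.OneWellSolvable F (Metric.ball pp Rp) pp)
    (hAm : Isoperimetric.OneWellSolvable F (Metric.ball pm Rm) pm)
    (hm₀ : 0 < m₀)
    (hlb : ∀ p, p ∉ Metric.ball pp Rp ∪ Metric.ball pm Rm → m₀ ≤ F p) :
    ∀ A₀ : ℝ, ∃ γ : ℝ → Isoperimetric.Plane,
      Isoperimetric.IsMinimizer F (Isoperimetric.twoWellClass pm pp A₀) γ := by
  intro A₀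
  have hFc : Continuous F := by
    have : F = fun p => √(W p) := funext fun p => by rw [hWF, Real.sqrt_sq (hF p)]
    rw [this]
    exact hWcont.sqrt
  have hF00 : ∀ p, F p = 0 ↔ p = pp ∨ p = pm := fun p => by
    rw [← hzero, hWF, sq_eq_zero_iff]
  have hpos : ∀ x, x ≠ pp → x ≠ pm → 0 < F x := fun x h1 h2 =>
    lt_of_le_of_ne (hF x) fun h => ((hF00 x).1 h.symm).elim h1 h2
  set R := min Rp Rm / 2 with hR
  have hmin : 0 < min Rp Rm := lt_min hRp hRm
  have hR0 : 0 < R := half_pos hmin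
  have hRRp : R < Rp := (half_lt_self hmin).trans_le (min_le_left _ _)
  have hRRm : R < Rm := (half_lt_self hmin).trans_le (min_le_right _ _)
  obtain ⟨c₁, hc₁, hlow₁⟩ := Isoperimetric.exists_linear_lower_bound hFc hF hWF hR0 hRRp hsmoothp
    hhessp ((hF00 pp).2 (Or.inl rfl)) fun x hx hxp => hpos x hxp fun h =>
      hdisj.le_bot ⟨Metric.closedBall_subset_ball hRRp hx, h ▸ Metric.mem_ball_self hRm⟩
  obtain ⟨c₂, hc₂, hlow₂⟩ := Isoperimetric.exists_linear_lower_bound hFc hF hWF hR0 hRRm hsmoothm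
    hhessm ((hF00 pm).2 (Or.inr rfl)) fun x hx hxp => hpos x (fun h =>
      hdisj.le_bot ⟨h ▸ Metric.mem_ball_self hRp, Metric.closedBall_subset_ball hRRm hx⟩) hxp
  obtain ⟨m, hm, hfar⟩ := Isoperimetric.exists_pos_le_of_far hFc hpos hm₀ hlb (half_pos hR0)
  exact Isoperimetric.exists_isMinimizer_twoWellClass hFc hF fun e he =>
    he.reachIn hFc hF hne hdisj hAp hAm (half_pos hR0) (half_lt_self hR0) hRRp hRRm
      (lt_min hc₁ hc₂)
      (fun x hx => (mul_le_mul_of_nonneg_right (min_le_left _ _) (norm_nonneg _)).trans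
        (hlow₁ x hx))
      (fun x hx => (mul_le_mul_of_nonneg_right (min_le_right _ _) (norm_nonneg _)).trans
        (hlow₂ x hx)) hm hfar
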